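/- Let $(X,d)$ be a metric space. Put $M_0=1$ and $M_k=2^{2^k}$ for $k\ge 1$. An admissible sequence is a sequence $(A_k)_{k\ge 0}$ of partitions of $X$ such that $A_{k+1}$ refines $A_k$ and $|A_k|\le M_k$ for all $k\ge 0$; $A_k(x)$ denotes the member of $A_k$ containing $x$. Define $$\gamma_2(X,d)=\inf_{(A_k)}\ \sup_{x\in X}\ \sum_{k\ge 0}2^{k/2}\,\mathrm{diam}(A_k(x))\in[0,\infty],$$ where the infimum is over all admissible sequences. Consider pairs $(\mathcal T,s)$, where $\mathcal T$ is a finite graph-theoretic tree whose vertices are points of $X$, with a fixed root $z$, and $s$ maps the vertices of $\mathcal T$ to $\mathbb Z$. For a vertex $x$, let $\Gamma(x)$ be the set of children of $x$, $\Delta(x)=|\Gamma(x)|+1$, $\mathcal T_x$ the subtree rooted at $x$ (consisting of $x$ and all its descendants), and $\mathcal P(x)$ the set of vertices on the path from $z$ to $x$, both endpoints included. Let $\mathcal L$ be the set of leaves, i.e. of vertices without children. For $r\ge 2$, the value of $(\mathcal T,s)$ is $$\mathsf{val}_r(\mathcal T,s)=\inf_{\ell\in\mathcal L}\ \sum_{v\in\mathcal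 P(\ell)}r^{s(v)}\sqrt{\log\Delta(v)},$$ and $(\mathcal T,s)$ is an $r$-separated tree in $X$ if the following hold for every vertex $x$ of $\mathcal T$: 1. $s(y)\le s(x)-2$ for all $y\in\Gamma(x)$; 2. $d(x,\mathcal T_u)\ge\frac12 r^{s(x)-1}$ for all $u\in\Gamma(x)$, and $d(\mathcal T_u,\mathcal T_v)\ge\frac12 r^{s(x)-1}$ for all distinct $u,v\in\Gamma(x)$; 3. $\mathrm{diam}(\mathcal T_x)\le 4r^{s(x)}$. Theorem. There is a universal constant $r_0\ge 2$ such that for every real $r\ge r_0$ there is a constant $C=C(r)>0$, depending only on $r$, such that for every metric space $(X,d)$, $$C^{-1}\,\gamma_2(X,d)\ \le\ \sup_{(\mathcal T,s)}\mathsf{val}_r(\mathcal T,s)\ \le\ C\,\gamma_2(X,d),$$ where the supremum is over all $r$-separated trees in $X$. Both quantities take values in $[0,\infty]$; in particular, one is infinite if and only if the other is. (For $X=\emptyset$ both suprema are over an empty set and equal $0$.) -/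

import Mathlib

open scoped ENNReal NNReal

noncomputable section

namespace MajorizingTrees

/-- The cardinality bounds `M 0 = 1` and `M k = 2 ^ 2 ^ k` for `k ≥ 1`. -/
def admissibleBound (k : ℕ) : ℕ := if k = 0 then 1 else 2 ^ 2 ^ k

/-- An admissible sequence of partitions of `X`. A partition is given by its equivalence relation:
its members are the classes, and `A (k + 1) ≤ A k` says that `A (k + 1)` refines `A k`. -/
structure IsAdmissible {X : Type*} (A : ℕ → Setoid X) : Prop where
  refines : ∀ k, A (k + 1) ≤ A k
  card_le : ∀ k, (A k).classes.encard ≤ (admissibleBound k : ℕ∞)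

/-- The member `P(x)` of the partition `P` that contains `x`. -/
def part {X : Type*} (P : Setoid X) (x : X) : Set X := {y | P y x}

/-- Talagrand's functional `γ₂(X, d)`, with values in `[0, ∞]`; diameters are taken in `[0, ∞]`. -/
def gammaTwo (X : Type*) [MetricSpace X] : ℝ≥0∞ :=
  ⨅ (A : ℕ → Setoid X) (_ : IsAdmissible A),
    ⨆ x : X, ∑' k : ℕ, (2 : ℝ≥0∞) ^ ((k : ℝ) / 2) * Metric.ediam (part (A k) x)

/-- A finite graph-theoretic tree whose vertices are points of `X`, with a root and an integer
label on each vertex. -/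
structure LabelledTree (X : Type*) where
  /-- the vertex set -/
  V : Finset X
  /-- the edges -/
  G : SimpleGraph V
  isTree : G.IsTree
  /-- the root `z` -/
  root : V
  /-- the labels -/
  s : V → ℤ

namespace LabelledTree

variable {X : Type*} (T : LabelledTree X)

open Classical in
/-- `𝒫(v)`: the nodes on the unique path from the root to `v`. -/
def path (v : T.V) : Finset T.V :=
  {u | ∃ p : T.G.Walk T.root v, p.IsPath ∧ u ∈ p.support}

open Classical in
/-- `Γ(x)`: the children of `x`, that is, the neighbours of `x` whose path to the root passes
through `x`. -/
def children (x : T.V) : Finset T.V := {y | T.G.Adj x y ∧ x ∈ T.path y}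

/-- `Δ(x) = |Γ(x)| + 1`. -/
def Delta (x : T.V) : ℕ := (T.children x).card + 1

/-- The vertices of the subtree `𝒯_x` rooted at `x`, as a set of points of `X`. -/
def subtree (x : T.V) : Set X := {p | ∃ y : T.V, x ∈ T.path y ∧ (y : X) = p}

/-- The leaves of the rooted tree: the nodes without children. -/
def leaves : Set T.V := {v | T.children v = ∅}

/-- `val_r(𝒯, s)`, the minimum over the leaves `ℓ` of the sum of `r ^ s(v) * √(log Δ(v))` over
the nodes `v` on the path from the root to `ℓ`. -/
def val (r : ℝ) : ℝ≥0∞ :=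
  ⨅ l ∈ T.leaves, ENNReal.ofReal (∑ v ∈ T.path l, r ^ T.s v * √(Real.log (T.Delta v)))

/-- `r`-separated trees in a metric space. A lower bound on the distance between two
(finite, nonempty) sets is stated for all pairs of points. -/
structure IsSeparated [MetricSpace X] (r : ℝ) : Prop where
  label_le : ∀ x, ∀ y ∈ T.children x, T.s y ≤ T.s x - 2
  le_dist_self : ∀ x, ∀ u ∈ T.children x, ∀ p ∈ T.subtree u,
    (1 / 2 : ℝ) * r ^ (T.s x - 1) ≤ dist (x : X) p
  le_dist : ∀ x, ∀ u ∈ T.children x, ∀ v ∈ T.children x, u ≠ v →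
    ∀ p ∈ T.subtree u, ∀ q ∈ T.subtree v, (1 / 2 : ℝ) * r ^ (T.s x - 1) ≤ dist p q
  diam_le : ∀ x, Metric.diam (T.subtree x) ≤ 4 * r ^ T.s x

end LabelledTree

/-- The supremum of `val_r(𝒯, s)` over all `r`-separated trees in `X`. -/
def supVal (X : Type*) [MetricSpace X] (r : ℝ) : ℝ≥0∞ :=
  ⨆ (T : LabelledTree X) (_ : T.IsSeparated r), T.val r

end MajorizingTrees

end

/-! Both bounds rest on the fact that `√(log 2^(2^n))` is of order `2^(n/2)`, so branching at a node
of a tree corresponds to a level of an admissible sequence.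

Trees are bounded by `γ₂`: fix an admissible sequence and a separated tree. A node `v` with `N`
children is matched with a level `k` at which there are fewer than `N` cells and `√(log Δ(v)) ≤ 2 ·
2^(k/2)` (`exists_level`; small `N` get `k = 0`). By pigeonhole, below some child every level-`k`
cell has diameter at least `r^(s(v)-1)/2` (`exists_child_forall_le_ediam`). Moving to such a child
at each node leads to one leaf `l` whose cells are large for every inner node of its path. Nodes
sharing the same `k` have distinct labels, so their contributions form a geometric sum controlled by
the diameter of the level-`k` cell of `l`.

`γ₂` is bounded by trees: let `F(A)` be the supremum of the values of the trees in `A` (`treeSup`).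
Trees in balls of radius `r^(j-3)` around `r^(j-1)`-separated points can be hung below a new root,
so `F` satisfies Talagrand's growth condition (`add_le_treeSup`). The partitioning scheme then
applies. At step `n` a piece inside a ball of radius `r^j` is cut greedily: centres nearly
maximizing `F` on small balls are chosen and the balls of radius `r^(j-1)` around them removed.
Either a point falls into one of these balls and its scale drops, or it survives all removals, and
then the growth condition makes `F` near it smaller than `F` of the piece by a multiple of `2^(n/2)
r^j` (`exists_split`). Along the pieces of a fixed point these losses telescope, while the other
terms decay geometrically (`sum_range_le`). The first term, of the order of the diameter, is bounded
by trees with one edge. -/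

noncomputable section

namespace MajorizingTrees

/-! ### Paths and descent in rooted trees -/

namespace LabelledTree

variable {X : Type*} (T : LabelledTree X)

theorem mem_path_iff {v u : T.V} {p : T.G.Walk T.root v} (hp : p.IsPath) :
    u ∈ T.path v ↔ u ∈ p.support := by
  classical
  simp only [path, Finset.mem_filter, Finset.mem_univ, true_and]
  refine ⟨fun ⟨q, hq, hu⟩ => ?_, fun hu => ⟨p, hp, hu⟩⟩
  have := (T.isTree.isAcyclic.subsingleton_path T.root v).elim ⟨q, hq⟩ ⟨p, hp⟩
  rw [Subtype.mk.injEq] at this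
  rwa [← this]

theorem exists_isPath (v : T.V) : ∃ p : T.G.Walk T.root v, p.IsPath := by
  obtain ⟨p, hp, -⟩ := T.isTree.existsUnique_path T.root v
  exact ⟨p, hp⟩

theorem self_mem_path (v : T.V) : v ∈ T.path v := by
  obtain ⟨p, hp⟩ := T.exists_isPath v
  rw [T.mem_path_iff hp]
  exact p.end_mem_support

theorem path_root : T.path T.root = {T.root} := by
  ext u
  rw [T.mem_path_iff (SimpleGraph.Walk.IsPath.nil (u := T.root))]
  simp

theorem path_subset {u v : T.V} (h : u ∈ T.path v) : T.path u ⊆ T.path v := by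
  classical
  obtain ⟨p, hp⟩ := T.exists_isPath v
  rw [T.mem_path_iff hp] at h
  intro w hw
  rw [T.mem_path_iff (hp.takeUntil h)] at hw
  rw [T.mem_path_iff hp]
  exact p.support_takeUntil_subset_support h hw

theorem mem_children_iff {x y : T.V} : y ∈ T.children x ↔ T.G.Adj x y ∧ x ∈ T.path y := by
  simp [children]

theorem adj_of_mem_children {x y : T.V} (h : y ∈ T.children x) : T.G.Adj x y :=
  (T.mem_children_iff.1 h).1

theorem mem_path_of_mem_children {x y : T.V} (h : y ∈ T.children x) : x ∈ T.path y :=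
  (T.mem_children_iff.1 h).2

theorem notMem_path_of_mem_children {x y : T.V} (h : y ∈ T.children x) : y ∉ T.path x := by
  classical
  obtain ⟨p, hp⟩ := T.exists_isPath y
  have hx := (T.mem_path_iff hp).1 (T.mem_path_of_mem_children h)
  rw [T.mem_path_iff (hp.takeUntil hx)]
  exact SimpleGraph.Walk.endpoint_notMem_support_takeUntil hp hx
    (T.adj_of_mem_children h).ne'

theorem path_of_mem_children {x y : T.V} (h : y ∈ T.children x) (w : T.V) :
    w ∈ T.path y ↔ w ∈ T.path x ∨ w = y := by
  obtain ⟨p, hp⟩ := T.exists_isPath x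
  have hy : y ∉ p.support := by
    rw [← T.mem_path_iff hp]; exact T.notMem_path_of_mem_children h
  rw [T.mem_path_iff (hp.concat hy (T.adj_of_mem_children h)), T.mem_path_iff hp]
  simp [SimpleGraph.Walk.support_concat]

/-- If every node `v` that is not a leaf has a child below which `Q v` holds everywhere, then some
leaf `l` satisfies `Q v l` for all the other nodes `v` on its path. -/
theorem exists_leaf_forall_path {Q : T.V → T.V → Prop}
    (hlabel : ∀ x, ∀ y ∈ T.children x, T.s y ≤ T.s x - 2)
    (hstep : ∀ v, v ∉ T.leaves → ∃ u ∈ T.children v, ∀ p, u ∈ T.path p → Q v p) :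
    ∃ l ∈ T.leaves, Set.InjOn T.s (T.path l : Set T.V) ∧ ∀ v ∈ T.path l, v ≠ l → Q v l := by
  classical
  -- The descent terminates because the path grows at each step. It carries along that the current
  -- label is minimal on the path, which keeps the labels distinct.
  suffices H : ∀ n : ℕ, ∀ v : T.V, Fintype.card T.V - (T.path v).card = n →
      (Set.InjOn T.s (T.path v : Set T.V) ∧ ∀ w ∈ T.path v, T.s v ≤ T.s w) →
      (∀ w ∈ T.path v, w ≠ v → ∀ p, v ∈ T.path p → Q w p) →
      ∃ l ∈ T.leaves, Set.InjOn T.s (T.path l : Set T.V) ∧ ∀ v ∈ T.path l, v ≠ l → Q v l by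
    refine H _ T.root rfl ?_ ?_
    · simp [path_root]
    · intro w hw hne
      simp [path_root] at hw
      exact absurd hw hne
  intro n
  induction n using Nat.strong_induction_on with
  | _ n ih =>
    intro v hn hs hQ
    by_cases hv : v ∈ T.leaves
    · exact ⟨v, hv, hs.1, fun w hw hne => hQ w hw hne v (T.self_mem_path v)⟩
    obtain ⟨u, hu, hup⟩ := hstep v hv
    have hpu := T.path_of_mem_children hu
    have hnot := T.notMem_path_of_mem_children hu
    have hins : T.path u = insert u (T.path v) := by
      ext w; rw [hpu w, Finset.mem_insert, or_comm]
    have hl := hlabel v u hu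
    refine ih _ ?_ u rfl ⟨?_, ?_⟩ ?_
    · have h1 : (T.path u).card = (T.path v).card + 1 := by
        rw [hins, Finset.card_insert_of_notMem hnot]
      have h2 : (T.path u).card ≤ Fintype.card T.V := Finset.card_le_univ _
      omega
    · rw [hins, Finset.coe_insert, Set.injOn_insert (by simpa using hnot)]
      refine ⟨hs.1, ?_⟩
      rintro ⟨w, hw, hwu⟩
      have := hs.2 w hw
      omega
    · intro w hw
      rcases (hpu w).1 hw with hw | rfl
      · have := hs.2 w hw
        omega
      · exact le_rfl
    · intro w hw hne p hp
      rcases (hpu w).1 hw with hw | rfl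
      · by_cases hwv : w = v
        · subst hwv
          exact hup p hp
        · exact hQ w hw hwv p (T.path_subset hp (T.mem_path_of_mem_children hu))
      · exact absurd rfl hne

end LabelledTree

/-! ### Values of separated trees are bounded by `γ₂` -/

theorem sum_le_two_mul_of_two_mul_le {ι : Type*} (B : Finset ι) (s : ι → ℤ) (f : ι → ℝ≥0∞)
    (hs : Set.InjOn s (B : Set ι)) (hf : ∀ v ∈ B, ∀ w ∈ B, s v < s w → 2 * f v ≤ f w) :
    ∀ D : ℝ≥0∞, (∀ v ∈ B, f v ≤ D) → ∑ v ∈ B, f v ≤ 2 * D := by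
  classical
  induction B using Finset.induction_on_max_value s with
  | empty => simp
  | insert a B ha hmax ih =>
    intro D hD
    rw [Finset.sum_insert ha]
    -- Below the largest label every term is at most `D / 2`, so induction gives `D + 2 * (D / 2)`.
    have h1 : ∑ v ∈ B, f v ≤ 2 * (D / 2) := by
      refine ih (hs.mono (by simp)) (fun v hv w hw => hf v (by simp [hv]) w (by simp [hw])) _ ?_
      intro v hv
      have hlt : s v < s a := lt_of_le_of_ne (hmax v hv) fun h =>
        ha (hs (by simp [hv]) (by simp) h ▸ hv)
      have := (hf v (by simp [hv]) a (by simp) hlt).trans (hD a (by simp))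
      rw [ENNReal.le_div_iff_mul_le (by simp) (by simp), mul_comm]
      exact this
    rw [ENNReal.mul_div_cancel (by simp) (by simp)] at h1
    rw [two_mul]
    exact add_le_add (hD a (by simp)) h1

/-- The least `k` with `N ≤ M (k + 1)` works: minimality gives `M k < N` unless `k = 0`, and `log (N
+ 1) ≤ (2^(k+1) + 1) log 2 ≤ 4 · 2^k`. -/
theorem exists_level (N : ℕ) (hN : 1 ≤ N) :
    ∃ k : ℕ, (k = 0 ∨ admissibleBound k < N) ∧
      √(Real.log ((N + 1 : ℕ) : ℝ)) ≤ 2 * (2 : ℝ) ^ ((k : ℝ) / 2) := by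
  classical
  have hex : ∃ k : ℕ, N ≤ admissibleBound (k + 1) := by
    refine ⟨N, ?_⟩
    simp only [admissibleBound, Nat.add_eq_zero_iff, one_ne_zero, and_false, if_false]
    have h1 : N < 2 ^ N := Nat.lt_two_pow_self
    have h2 : N ≤ 2 ^ (N + 1) := by rw [pow_succ]; omega
    exact h1.le.trans (Nat.pow_le_pow_right (by norm_num) h2)
  refine ⟨Nat.find hex, ?_, ?_⟩
  · rcases Nat.eq_zero_or_pos (Nat.find hex) with h | h
    · exact Or.inl h
    · right
      have := Nat.find_min hex (m := Nat.find hex - 1) (by omega)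
      rw [Nat.sub_add_cancel h] at this
      omega
  · have hk := Nat.find_spec hex
    set k := Nat.find hex
    simp only [admissibleBound, Nat.add_eq_zero_iff, one_ne_zero, and_false, if_false] at hk
    have h1 : ((N + 1 : ℕ) : ℝ) ≤ (2 : ℝ) ^ (2 ^ (k + 1) + 1) := by
      have : N + 1 ≤ 2 ^ (2 ^ (k + 1) + 1) := by
        rw [pow_succ]
        have : 1 ≤ 2 ^ 2 ^ (k + 1) := Nat.one_le_two_pow
        omega
      exact_mod_cast this
    have h2 : Real.log ((N + 1 : ℕ) : ℝ) ≤ 4 * 2 ^ k := by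
      refine (Real.log_le_log (by positivity) h1).trans ?_
      rw [Real.log_pow]
      have h3 := Real.log_two_lt_d9
      have h4 : (1 : ℝ) ≤ 2 ^ k := one_le_pow₀ (by norm_num)
      have h5 : 0 < Real.log 2 := Real.log_pos (by norm_num)
      push_cast
      rw [pow_succ]
      nlinarith
    have h3 : (2 * (2 : ℝ) ^ ((k : ℝ) / 2)) = √(4 * 2 ^ k) := by
      rw [Real.sqrt_mul (by norm_num), Real.sqrt_eq_rpow (2 ^ k), ← Real.rpow_natCast,
        ← Real.rpow_mul (by norm_num), show (4 : ℝ) = 2 ^ 2 by norm_num,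
        Real.sqrt_sq (by norm_num)]
      congr 2
      ring
    rw [h3]
    exact Real.sqrt_le_sqrt h2

theorem classes_eq_of_encard_le_one {X : Type*} {A : Setoid X} (h : A.classes.encard ≤ 1) (x y : X) :
    A x y := by
  rw [Set.encard_le_one_iff] at h
  have := h _ _ (A.mem_classes x) (A.mem_classes y)
  have hx : x ∈ {z | A z x} := A.refl x
  rw [this] at hx
  exact hx

theorem ofReal_le_ediam_part {X : Type*} [MetricSpace X] {A : Setoid X} {x y z : X} {a : ℝ}
    (hy : A y x) (hz : A z x) (h : a ≤ dist y z) :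
    ENNReal.ofReal a ≤ Metric.ediam (part A x) := by
  refine (ENNReal.ofReal_le_ofReal h).trans ?_
  rw [← edist_dist]
  exact Metric.edist_le_ediam_of_mem hy hz

/-- Below some child of a node, all cells of a partition with few members are large. -/
theorem exists_child_forall_le_ediam {X : Type*} [MetricSpace X] {r : ℝ} {T : LabelledTree X}
    (hT : T.IsSeparated r) {A : ℕ → Setoid X} (hA : IsAdmissible A) {v : T.V} (k : ℕ)
    (hv : (T.children v).Nonempty) (hk : k = 0 ∨ admissibleBound k < (T.children v).card) :
    ∃ u ∈ T.children v, ∀ p, u ∈ T.path p →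
      ENNReal.ofReal (1 / 2 * r ^ (T.s v - 1)) ≤ Metric.ediam (part (A k) (p : X)) := by
  classical
  rcases hk with rfl | hk
  -- Level `0` has a single cell, which contains `v` as well. The separation of `v` from its
  -- subtrees replaces the pigeonhole argument, which would fail for a single child.
  · obtain ⟨u, hu⟩ := hv
    refine ⟨u, hu, fun p hp => ?_⟩
    have h1 : (A 0).classes.encard ≤ 1 := by simpa [admissibleBound] using hA.card_le 0
    exact ofReal_le_ediam_part (classes_eq_of_encard_le_one h1 v p) ((A 0).refl p)
      (hT.le_dist_self v u hu p ⟨p, hp, rfl⟩)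
  -- Otherwise each child has a point below it with a small cell. There are more children than
  -- cells, so two of these points share a cell, although they are far apart.
  · by_contra! hcon
    choose! q hq hlt using hcon
    have hfin : (A k).classes.Finite :=
      Set.finite_of_encard_le_coe (hA.card_le k)
    have hcard : hfin.toFinset.card < (T.children v).card := by
      refine lt_of_le_of_lt ?_ hk
      have := hA.card_le k
      rw [hfin.encard_eq_coe_toFinset_card] at this
      exact_mod_cast this
    obtain ⟨u, hu, u', hu', hne, heq⟩ :=
      Finset.exists_ne_map_eq_of_card_lt_of_maps_to hcard
        (f := fun u => {z | (A k) z (q u : X)}) (by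
          intro u hu
          simpa using (A k).mem_classes (q u : X))
    have hrel : (A k) (q u : X) (q u' : X) := by
      have hx : (q u : X) ∈ {z | (A k) z (q u : X)} := (A k).refl _
      rw [heq] at hx
      exact hx
    exact absurd (ofReal_le_ediam_part hrel ((A k).refl _)
      (hT.le_dist v u hu u' hu' hne _ ⟨q u, hq u hu, rfl⟩ _ ⟨q u', hq u' hu', rfl⟩))
      (not_le.2 (hlt u' hu'))

theorem ofReal_two_rpow (k : ℕ) :
    ENNReal.ofReal ((2 : ℝ) ^ ((k : ℝ) / 2)) = (2 : ℝ≥0∞) ^ ((k : ℝ) / 2) := by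
  rw [← ENNReal.ofReal_rpow_of_pos (by norm_num)]
  norm_num

theorem val_le_of_isAdmissible {X : Type*} [MetricSpace X] {r : ℝ} (hr : 2 ≤ r)
    {T : LabelledTree X} (hT : T.IsSeparated r) {A : ℕ → Setoid X} (hA : IsAdmissible A) :
    T.val r ≤ ENNReal.ofReal (8 * r) *
      ⨆ x : X, ∑' k : ℕ, (2 : ℝ≥0∞) ^ ((k : ℝ) / 2) * Metric.ediam (part (A k) x) := by
  classical
  have hr0 : 0 < r := by linarith
  obtain ⟨l, hl, hinj, hQ⟩ := T.exists_leaf_forall_path (Q := fun v p => ∃ k : ℕ,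
      √(Real.log (T.Delta v)) ≤ 2 * (2 : ℝ) ^ ((k : ℝ) / 2) ∧
      ENNReal.ofReal (1 / 2 * r ^ (T.s v - 1)) ≤ Metric.ediam (part (A k) (p : X)))
    hT.label_le (by
      intro v hv
      have hne : (T.children v).Nonempty := Finset.nonempty_iff_ne_empty.2 hv
      obtain ⟨k, hk, hlog⟩ := exists_level _ hne.card_pos
      obtain ⟨u, hu, h⟩ := exists_child_forall_le_ediam hT hA k hne hk
      exact ⟨u, hu, fun p hp => ⟨k, hlog, h p hp⟩⟩)
  choose! κ hκ using hQ
  refine (iInf₂_le l hl).trans ?_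
  refine le_trans ?_ (mul_le_mul_right (le_iSup _ (l : X)) _)
  have hleaf : √(Real.log (T.Delta l)) = 0 := by
    have : T.children l = ∅ := hl
    simp [LabelledTree.Delta, this]
  set B := (T.path l).erase l
  have hB : ∀ v ∈ B, v ∈ T.path l ∧ v ≠ l := fun v hv =>
    ⟨Finset.mem_of_mem_erase hv, Finset.ne_of_mem_erase hv⟩
  have hsum : ∑ v ∈ T.path l, r ^ T.s v * √(Real.log (T.Delta v))
      = ∑ v ∈ B, r ^ T.s v * √(Real.log (T.Delta v)) := by
    rw [← Finset.add_sum_erase _ _ (T.self_mem_path l), hleaf]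
    simp [B]
  rw [hsum, ENNReal.ofReal_sum_of_nonneg (fun v _ => by positivity)]
  calc ∑ v ∈ B, ENNReal.ofReal (r ^ T.s v * √(Real.log (T.Delta v)))
      ≤ ∑ v ∈ B, 2 * (2 : ℝ≥0∞) ^ ((κ v : ℝ) / 2) * ENNReal.ofReal (r ^ T.s v) := by
        refine Finset.sum_le_sum fun v hv => ?_
        have h := (hκ v (hB v hv).1 (hB v hv).2).1
        rw [← ofReal_two_rpow, show (2 : ℝ≥0∞) = ENNReal.ofReal 2 by norm_num,
          ← ENNReal.ofReal_mul (by norm_num), ← ENNReal.ofReal_mul (by positivity), mul_comm]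
        exact ENNReal.ofReal_le_ofReal (by gcongr)
    _ = ∑ k ∈ B.image κ, ∑ v ∈ B with κ v = k,
          2 * (2 : ℝ≥0∞) ^ ((κ v : ℝ) / 2) * ENNReal.ofReal (r ^ T.s v) :=
        (Finset.sum_fiberwise_of_maps_to (fun v hv => Finset.mem_image_of_mem _ hv) _).symm
    _ ≤ ∑ k ∈ B.image κ, ENNReal.ofReal (8 * r) *
          ((2 : ℝ≥0∞) ^ ((k : ℝ) / 2) * Metric.ediam (part (A k) (l : X))) := by
        refine Finset.sum_le_sum fun k _ => ?_
        -- For fixed `k` the labels are distinct integers and `r ≥ 2`, so the powers at least double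
        -- from one to the next. Each is at most `2 * r` times the diameter of the same cell.
        have h1 : ∑ v ∈ B with κ v = k, ENNReal.ofReal (r ^ T.s v)
            ≤ 2 * (ENNReal.ofReal (2 * r) * Metric.ediam (part (A k) (l : X))) := by
          refine sum_le_two_mul_of_two_mul_le _ T.s _ (hinj.mono ?_) ?_ _ ?_
          · intro v hv
            simp only [Finset.coe_filter, Set.mem_ofPred_eq] at hv
            exact (hB v hv.1).1
          · intro v _ w _ hvw
            rw [show (2 : ℝ≥0∞) = ENNReal.ofReal 2 by norm_num,
              ← ENNReal.ofReal_mul (by norm_num)]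
            apply ENNReal.ofReal_le_ofReal
            calc 2 * r ^ T.s v ≤ r * r ^ T.s v := by gcongr
              _ = r ^ (T.s v + 1) := by rw [zpow_add_one₀ hr0.ne', mul_comm]
              _ ≤ r ^ T.s w := zpow_le_zpow_right₀ (by linarith) hvw
          · intro v hv
            rw [Finset.mem_filter] at hv
            have h := (hκ v (hB v hv.1).1 (hB v hv.1).2).2
            rw [hv.2] at h
            refine le_trans ?_ (mul_le_mul_right h _)
            rw [← ENNReal.ofReal_mul (by positivity), zpow_sub_one₀ hr0.ne']
            apply ENNReal.ofReal_le_ofReal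
            apply le_of_eq
            field_simp
        calc _ = ∑ v ∈ B with κ v = k,
              2 * (2 : ℝ≥0∞) ^ ((k : ℝ) / 2) * ENNReal.ofReal (r ^ T.s v) := by
              refine Finset.sum_congr rfl fun v hv => ?_
              rw [(Finset.mem_filter.1 hv).2]
          _ = 2 * (2 : ℝ≥0∞) ^ ((k : ℝ) / 2) * ∑ v ∈ B with κ v = k,
              ENNReal.ofReal (r ^ T.s v) := by rw [Finset.mul_sum]
          _ ≤ 2 * (2 : ℝ≥0∞) ^ ((k : ℝ) / 2) *
              (2 * (ENNReal.ofReal (2 * r) * Metric.ediam (part (A k) (l : X)))) :=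
              mul_le_mul_right h1 _
          _ = _ := by
              have h2 : ENNReal.ofReal (8 * r) = 4 * ENNReal.ofReal (2 * r) := by
                rw [← ENNReal.ofReal_ofNat 4, ← ENNReal.ofReal_mul (by norm_num)]
                congr 1
                ring
              rw [h2]
              ring
    _ = ENNReal.ofReal (8 * r) * ∑ k ∈ B.image κ,
          ((2 : ℝ≥0∞) ^ ((k : ℝ) / 2) * Metric.ediam (part (A k) (l : X))) := by
        rw [Finset.mul_sum]
    _ ≤ _ := mul_le_mul_right (ENNReal.sum_le_tsum _) _

theorem supVal_le_gammaTwo (X : Type*) [MetricSpace X] {r : ℝ} (hr : 2 ≤ r) :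
    supVal X r ≤ ENNReal.ofReal (8 * r) * gammaTwo X := by
  have h0 : ENNReal.ofReal (8 * r) ≠ 0 := by simp; linarith
  refine iSup₂_le fun T hT => ?_
  rw [gammaTwo, ENNReal.mul_iInf_of_ne h0 ENNReal.ofReal_ne_top]
  refine le_iInf fun A => ?_
  rw [ENNReal.mul_iInf_of_ne h0 ENNReal.ofReal_ne_top]
  exact le_iInf fun hA => val_le_of_isAdmissible hr hT hA

/-! ### Separated trees given by parent functions -/

open Classical in
/-- The children of `x` in the tree on `V` with the given root and parent function. -/
def parentChildren {X : Type*} (V : Finset X) (root : X) (par : X → X) (x : X) : Finset X :=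
  {y ∈ V | y ≠ root ∧ par y = x}

/-- An `r`-separated tree given by its parent function. The set `below x` contains the subtree at
`x`, and `weight x` is at most the sum of the weights on the path from the root to `x`. -/
structure ParentTree (X : Type*) [MetricSpace X] (r : ℝ) where
  V : Finset X
  root : X
  par : X → X
  height : X → ℕ
  s : X → ℤ
  below : X → Set X
  weight : X → ℝ
  root_mem : root ∈ V
  par_mem : ∀ x ∈ V, x ≠ root → par x ∈ V
  height_lt : ∀ x ∈ V, x ≠ root → height (par x) < height x
  self_mem : ∀ x ∈ V, x ∈ below x
  below_subset : ∀ x ∈ V, x ≠ root → below x ⊆ below (par x)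
  below_subset_V : ∀ x ∈ V, below x ⊆ V
  label_le : ∀ x ∈ V, x ≠ root → s x ≤ s (par x) - 2
  le_dist_self : ∀ x ∈ V, x ≠ root → ∀ p ∈ below x,
    (1 / 2 : ℝ) * r ^ (s (par x) - 1) ≤ dist (par x) p
  le_dist : ∀ x ∈ V, ∀ y ∈ V, x ≠ root → y ≠ root → x ≠ y → par x = par y →
    ∀ p ∈ below x, ∀ q ∈ below y, (1 / 2 : ℝ) * r ^ (s (par x) - 1) ≤ dist p q
  diam_le : ∀ x ∈ V, ∀ p ∈ below x, ∀ q ∈ below x, dist p q ≤ 4 * r ^ s x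
  weight_root : weight root ≤
    r ^ s root * √(Real.log (((parentChildren V root par root).card + 1 : ℕ) : ℝ))
  weight_le : ∀ x ∈ V, x ≠ root → weight x ≤ weight (par x) +
    r ^ s x * √(Real.log (((parentChildren V root par x).card + 1 : ℕ) : ℝ))

namespace ParentTree

variable {X : Type*} [MetricSpace X] {r : ℝ} (P : ParentTree X r)

/-- All leaves have weight at least `w`. -/
def ValueGE (w : ℝ) : Prop :=
  ∀ x ∈ P.V, parentChildren P.V P.root P.par x = ∅ → w ≤ P.weight x

/-- The underlying graph. -/
def graph : SimpleGraph P.V where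
  Adj x y := ((y : X) ≠ P.root ∧ P.par y = x) ∨ ((x : X) ≠ P.root ∧ P.par x = y)
  symm := ⟨fun _ _ h => h.symm⟩
  loopless := ⟨fun x h => by
    have h' : (x : X) ≠ P.root ∧ P.par x = x := by tauto
    have := P.height_lt x x.2 h'.1
    rw [h'.2] at this
    exact lt_irrefl _ this⟩

theorem reachable_root (v : P.V) : P.graph.Reachable ⟨P.root, P.root_mem⟩ v := by
  induction hn : P.height v using Nat.strong_induction_on generalizing v with
  | _ n ih =>
    by_cases hv : (v : X) = P.root
    · have : v = ⟨P.root, P.root_mem⟩ := Subtype.ext hv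
      rw [this]
    · refine (ih _ (hn ▸ P.height_lt v v.2 hv) ⟨P.par v, P.par_mem v v.2 hv⟩ rfl).trans ?_
      exact SimpleGraph.Adj.reachable (Or.inl ⟨hv, rfl⟩)

/-- A connected graph is a tree once it has at most `|V| - 1` edges; here every edge joins a
non-root vertex to its parent. -/
theorem graph_isTree : P.graph.IsTree := by
  classical
  have hconn : P.graph.Connected :=
    { preconnected := fun u v => (P.reachable_root u).symm.trans (P.reachable_root v)
      nonempty := ⟨⟨P.root, P.root_mem⟩⟩ }
  rw [SimpleGraph.isTree_iff_connected_and_card]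
  refine ⟨hconn, le_antisymm ?_ hconn.card_vert_le_card_edgeSet_add_one⟩
  let f : P.V → Sym2 P.V := fun x =>
    if h : (x : X) = P.root then s(x, x) else s(x, ⟨P.par x, P.par_mem x x.2 h⟩)
  let S : Finset P.V := Finset.univ.erase ⟨P.root, P.root_mem⟩
  have hsub : P.graph.edgeSet ⊆ (S.image f : Finset (Sym2 P.V)) := by
    intro e
    induction e using Sym2.ind with
    | _ x y =>
      intro h
      simp only [Finset.coe_image, Set.mem_image]
      rcases h with ⟨h1, h2⟩ | ⟨h1, h2⟩
      · refine ⟨y, by simp [S, Subtype.ext_iff, h1], ?_⟩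
        simp only [f, dif_neg h1]
        rw [Sym2.eq_swap]
        congr 2
      · refine ⟨x, by simp [S, Subtype.ext_iff, h1], ?_⟩
        simp only [f, dif_neg h1]
        congr 2
  have h1 : Nat.card P.graph.edgeSet ≤ S.card := by
    refine (Nat.card_mono (Finset.finite_toSet _) hsub).trans ?_
    simp only [Finset.coe_sort_coe, Nat.card_eq_fintype_card, Fintype.card_coe]
    exact Finset.card_image_le
  have h2 : S.card + 1 = Nat.card P.V := by
    rw [Nat.card_eq_fintype_card]
    exact Finset.card_erase_add_one (Finset.mem_univ _)
  omega

/-- The labelled tree with the given parent function. -/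
def toLabelledTree : LabelledTree X where
  V := P.V
  G := P.graph
  isTree := P.graph_isTree
  root := ⟨P.root, P.root_mem⟩
  s v := P.s v

/-- The claims are proved together: heights on the path to the parent are below that of `v`, so `v`
is not on it and the path extends by one edge. -/
theorem mem_path_toLabelledTree (v : P.toLabelledTree.V) :
    (∀ w ∈ P.toLabelledTree.path v, P.height w ≤ P.height v ∧ P.below v ⊆ P.below w) ∧
    ((v : X) ≠ P.root → ∃ u : P.toLabelledTree.V, (u : X) = P.par v ∧
      v ∈ P.toLabelledTree.children u) := by
  induction hn : P.height v using Nat.strong_induction_on generalizing v with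
  | _ n ih =>
    by_cases hv : (v : X) = P.root
    · refine ⟨fun w hw => ?_, fun h => absurd hv h⟩
      have : v = P.toLabelledTree.root := Subtype.ext hv
      rw [this, P.toLabelledTree.path_root, Finset.mem_singleton, ← this] at hw
      subst hw
      exact ⟨hn.le, subset_rfl⟩
    · obtain ⟨u, hu⟩ : ∃ u : P.toLabelledTree.V, (u : X) = P.par v :=
        ⟨⟨P.par v, P.par_mem v v.2 hv⟩, rfl⟩
      have hlt := P.height_lt v v.2 hv
      rw [← hu] at hlt
      have ih' := ih _ (hn ▸ hlt) u rfl
      have hadj : P.toLabelledTree.G.Adj u v := Or.inl ⟨hv, hu.symm⟩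
      obtain ⟨p, hp⟩ := P.toLabelledTree.exists_isPath u
      have hvp : v ∉ p.support := by
        intro h
        have := (ih'.1 v ((P.toLabelledTree.mem_path_iff hp).2 h)).1
        omega
      have hc : v ∈ P.toLabelledTree.children u := by
        refine P.toLabelledTree.mem_children_iff.2 ⟨hadj, ?_⟩
        rw [P.toLabelledTree.mem_path_iff (hp.concat hvp hadj)]
        simp [SimpleGraph.Walk.support_concat]
      refine ⟨fun w hw => ?_, fun _ => ⟨u, hu, hc⟩⟩
      rcases (P.toLabelledTree.path_of_mem_children hc w).1 hw with hw | rfl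
      · have hw' := ih'.1 w hw
        refine ⟨by omega, subset_trans ?_ hw'.2⟩
        rw [hu]
        exact P.below_subset v v.2 hv
      · exact ⟨hn.le, subset_rfl⟩

theorem mem_children_toLabelledTree {u v : P.toLabelledTree.V} :
    v ∈ P.toLabelledTree.children u ↔ (v : X) ≠ P.root ∧ P.par v = u := by
  constructor
  · intro h
    rcases P.toLabelledTree.adj_of_mem_children h with h' | ⟨h1, h2⟩
    · exact h'
    · have h3 := ((P.mem_path_toLabelledTree v).1 u
        (P.toLabelledTree.mem_path_of_mem_children h)).1
      have h4 := P.height_lt u u.2 h1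
      rw [h2] at h4
      omega
  · rintro ⟨h1, h2⟩
    obtain ⟨w, hw, hc⟩ := (P.mem_path_toLabelledTree v).2 h1
    have : w = u := Subtype.ext (hw.trans h2)
    rwa [← this]

theorem image_children_toLabelledTree (v : P.toLabelledTree.V) :
    (P.toLabelledTree.children v).map (Function.Embedding.subtype _) =
      parentChildren P.V P.root P.par v := by
  ext y
  simp only [Finset.mem_map, Function.Embedding.subtype_apply, parentChildren, Finset.mem_filter]
  constructor
  · rintro ⟨u, hu, rfl⟩
    exact ⟨u.2, P.mem_children_toLabelledTree.1 hu⟩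
  · rintro ⟨h1, h2⟩
    exact ⟨⟨y, h1⟩, P.mem_children_toLabelledTree.2 h2, rfl⟩

theorem Delta_toLabelledTree (v : P.toLabelledTree.V) :
    P.toLabelledTree.Delta v = (parentChildren P.V P.root P.par v).card + 1 := by
  rw [← P.image_children_toLabelledTree, Finset.card_map, LabelledTree.Delta]

theorem subtree_toLabelledTree_subset (v : P.toLabelledTree.V) :
    P.toLabelledTree.subtree v ⊆ P.below v := by
  rintro _ ⟨y, hy, rfl⟩
  exact ((P.mem_path_toLabelledTree y).1 v hy).2 (P.self_mem y y.2)

theorem toLabelledTree_isSeparated (hr : 0 < r) : P.toLabelledTree.IsSeparated r where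
  label_le x y hy := by
    obtain ⟨h1, h2⟩ := P.mem_children_toLabelledTree.1 hy
    have := P.label_le y y.2 h1
    rwa [h2] at this
  le_dist_self x u hu p hp := by
    obtain ⟨h1, h2⟩ := P.mem_children_toLabelledTree.1 hu
    have := P.le_dist_self u u.2 h1 p (P.subtree_toLabelledTree_subset u hp)
    rwa [h2] at this
  le_dist x u hu v hv huv p hp q hq := by
    obtain ⟨h1, h2⟩ := P.mem_children_toLabelledTree.1 hu
    obtain ⟨h3, h4⟩ := P.mem_children_toLabelledTree.1 hv
    have := P.le_dist u u.2 v v.2 h1 h3 (fun h => huv (Subtype.ext h)) (h2.trans h4.symm)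
      p (P.subtree_toLabelledTree_subset u hp) q (P.subtree_toLabelledTree_subset v hq)
    rwa [h2] at this
  diam_le x := by
    refine Metric.diam_le_of_forall_dist_le (mul_nonneg (by norm_num) (zpow_nonneg hr.le _)) ?_
    intro p hp q hq
    exact P.diam_le x x.2 p (P.subtree_toLabelledTree_subset x hp) q
      (P.subtree_toLabelledTree_subset x hq)

theorem weight_le_sum (v : P.toLabelledTree.V) :
    P.weight v ≤ ∑ u ∈ P.toLabelledTree.path v,
      r ^ P.toLabelledTree.s u * √(Real.log (P.toLabelledTree.Delta u)) := by
  classical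
  induction hn : P.height v using Nat.strong_induction_on generalizing v with
  | _ n ih =>
    by_cases hv : (v : X) = P.root
    · have : v = P.toLabelledTree.root := Subtype.ext hv
      rw [this, P.toLabelledTree.path_root, Finset.sum_singleton, Delta_toLabelledTree]
      exact P.weight_root
    · obtain ⟨u, hu, hc⟩ := (P.mem_path_toLabelledTree v).2 hv
      have hins : P.toLabelledTree.path v = insert v (P.toLabelledTree.path u) := by
        ext w
        rw [P.toLabelledTree.path_of_mem_children hc, Finset.mem_insert, or_comm]
      rw [hins, Finset.sum_insert (P.toLabelledTree.notMem_path_of_mem_children hc),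
        Delta_toLabelledTree]
      have hlt := P.height_lt v v.2 hv
      rw [← hu] at hlt
      have h1 := ih _ (hn ▸ hlt) u rfl
      have h2 := P.weight_le v v.2 hv
      rw [← hu] at h2
      refine h2.trans ?_
      rw [add_comm]
      exact add_le_add_right h1 _

theorem ofReal_le_val {w : ℝ} (h : P.ValueGE w) :
    ENNReal.ofReal w ≤ P.toLabelledTree.val r := by
  refine le_iInf₂ fun l hl => ENNReal.ofReal_le_ofReal ?_
  refine (h l l.2 ?_).trans (P.weight_le_sum l)
  have : P.toLabelledTree.children l = ∅ := hl
  rw [← P.image_children_toLabelledTree, this, Finset.map_empty]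

theorem ofReal_le_supVal (hr : 0 < r) {w : ℝ} (h : P.ValueGE w) :
    ENNReal.ofReal w ≤ supVal X r :=
  (P.ofReal_le_val h).trans
    (le_iSup₂ (f := fun (T : LabelledTree X) (_ : T.IsSeparated r) => T.val r) P.toLabelledTree
      (P.toLabelledTree_isSeparated hr))

end ParentTree

/-! ### Joining trees below a new root -/

theorem mem_parentChildren {X : Type*} {V : Finset X} {root : X} {par : X → X} {x y : X} :
    y ∈ parentChildren V root par x ↔ y ∈ V ∧ y ≠ root ∧ par y = x := by
  simp [parentChildren]

theorem sqrt_log_succ_mono {m n : ℕ} (h : m ≤ n) :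
    √(Real.log ((m + 1 : ℕ) : ℝ)) ≤ √(Real.log ((n + 1 : ℕ) : ℝ)) := by
  apply Real.sqrt_le_sqrt
  apply Real.log_le_log (by positivity)
  exact_mod_cast Nat.succ_le_succ h

namespace ParentTree

variable {X : Type*} [MetricSpace X] {r : ℝ}

/-- The tree with one vertex. -/
def singleton (hr : 0 < r) (t : X) (σ : ℤ) : ParentTree X r where
  V := {t}
  root := t
  par := id
  height _ := 0
  s _ := σ
  below x := {x}
  weight _ := 0
  root_mem := by simp
  par_mem := by simp
  height_lt x hx h := absurd (by simpa using hx) h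
  self_mem := by simp
  below_subset := by simp
  below_subset_V := by simp
  label_le x hx h := absurd (by simpa using hx) h
  le_dist_self x hx h := absurd (by simpa using hx) h
  le_dist x hx y hy h := absurd (by simpa using hx) h
  diam_le x _ p hp q hq := by
    rw [Set.mem_singleton_iff] at hp hq
    subst hp hq
    rw [dist_self]
    exact mul_nonneg (by norm_num) (zpow_nonneg hr.le _)
  weight_root := mul_nonneg (zpow_nonneg hr.le _) (Real.sqrt_nonneg _)
  weight_le x hx h := absurd (by simpa using hx) h

/-- The separated trees `P i` can be joined by a new root `z`. -/
theorem exists_glue (hr : 0 < r) {ι : Type*} [Fintype ι] [Nonempty ι] (P : ι → ParentTree X r)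
    (z : X) (j : ℤ) {w : ℝ}
    (hsep : ∀ i k, i ≠ k → ∀ p ∈ (P i).V, ∀ q ∈ (P k).V, (1 / 2 : ℝ) * r ^ (j - 1) ≤ dist p q)
    (hz : ∀ i, ∀ p ∈ (P i).V, (1 / 2 : ℝ) * r ^ (j - 1) ≤ dist z p)
    (hlabel : ∀ i, (P i).s (P i).root ≤ j - 2)
    (hdiam : ∀ i k, ∀ p ∈ (P i).V, ∀ q ∈ (P k).V, dist p q ≤ 4 * r ^ j)
    (hzdiam : ∀ i, ∀ p ∈ (P i).V, dist z p ≤ 4 * r ^ j)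
    (hw : ∀ i, (P i).ValueGE w) :
    ∃ Q : ParentTree X r, (∀ x ∈ Q.V, x = z ∨ ∃ i, x ∈ (P i).V) ∧
      Q.ValueGE (r ^ j * √(Real.log ((Fintype.card ι + 1 : ℕ) : ℝ)) + w) := by
  classical
  have hpos : 0 < (1 / 2 : ℝ) * r ^ (j - 1) := by positivity
  -- The trees lie at positive distance from each other, so each vertex determines its tree.
  obtain ⟨c, hc⟩ : ∃ c : X → ι, ∀ i, ∀ x ∈ (P i).V, c x = i := by
    refine ⟨fun x => if h : ∃ i, x ∈ (P i).V then h.choose else Classical.arbitrary ι, ?_⟩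
    intro i x hx
    have h : ∃ i, x ∈ (P i).V := ⟨i, hx⟩
    beta_reduce
    rw [dif_pos h]
    by_contra hne
    have := hsep _ _ hne x h.choose_spec x hx
    rw [dist_self] at this
    linarith
  have hne : ∀ i, ∀ x ∈ (P i).V, x ≠ z := by
    rintro i x hx rfl
    have := hz i x hx
    rw [dist_self] at this
    linarith
  have hnz : ∀ i, ∀ x ∈ (P i).V, c x = i ∧ x ≠ z := fun i x hx => ⟨hc i x hx, hne i x hx⟩
  set g : ℝ := r ^ j * √(Real.log ((Fintype.card ι + 1 : ℕ) : ℝ))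
  let V : Finset X := insert z (Finset.univ.biUnion fun i => (P i).V)
  have hV : ∀ x, x ∈ V ↔ x = z ∨ ∃ i, x ∈ (P i).V := by simp [V]
  have hVi : ∀ i, ∀ x ∈ (P i).V, x ∈ V := fun i x hx => (hV x).2 (Or.inr ⟨i, hx⟩)
  have hVz : ∀ x ∈ V, x ≠ z → ∃ i, x ∈ (P i).V := fun x hx h =>
    ((hV x).1 hx).resolve_left h
  let par : X → X := fun x => if x = (P (c x)).root then z else (P (c x)).par x
  have hpar_root : ∀ i, par (P i).root = z := by
    intro i
    simp [par, hc i _ (P i).root_mem]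
  have hpar : ∀ i, ∀ x ∈ (P i).V, x ≠ (P i).root → par x = (P i).par x := by
    intro i x hx hxr
    simp [par, hc i x hx, hxr]
  let height : X → ℕ := fun x => if x = z then 0 else (P (c x)).height x + 1
  let s : X → ℤ := fun x => if x = z then j else (P (c x)).s x
  let below : X → Set X := fun x => if x = z then V else (P (c x)).below x
  let weight : X → ℝ := fun x => if x = z then g else g + (P (c x)).weight x
  have hheight : ∀ i, ∀ x ∈ (P i).V, height x = (P i).height x + 1 := by
    intro i x hx; simp [height, hnz i x hx]
  have hs : ∀ i, ∀ x ∈ (P i).V, s x = (P i).s x := by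
    intro i x hx; simp [s, hnz i x hx]
  have hbelow : ∀ i, ∀ x ∈ (P i).V, below x = (P i).below x := by
    intro i x hx; simp [below, hnz i x hx]
  have hweight : ∀ i, ∀ x ∈ (P i).V, weight x = g + (P i).weight x := by
    intro i x hx; simp [weight, hnz i x hx]
  have hheightz : height z = 0 := by simp [height]
  have hsz : s z = j := by simp [s]
  have hbelowz : below z = V := by simp [below]
  have hweightz : weight z = g := by simp [weight]
  -- An inclusion suffices: weights are only lower bounds, and a leaf of the new tree is then a leaf
  -- of its `P i`.
  have hchildren : ∀ i, ∀ x, parentChildren (P i).V (P i).root (P i).par x ⊆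
      parentChildren V z par x := by
    intro i x y hy
    rw [mem_parentChildren] at hy ⊢
    exact ⟨hVi i y hy.1, hne i y hy.1, (hpar i y hy.1 hy.2.1).trans hy.2.2⟩
  have hchildrenz : Fintype.card ι ≤ (parentChildren V z par z).card := by
    rw [← Finset.card_univ]
    refine Finset.card_le_card_of_injOn (fun i => (P i).root) ?_ ?_
    · intro i _
      simp only [Finset.mem_coe, mem_parentChildren]
      exact ⟨hVi i _ (P i).root_mem, hne i _ (P i).root_mem, hpar_root i⟩
    · intro i _ k _ hik
      have h1 := hc i _ (P i).root_mem
      have h2 := hc k _ (P k).root_mem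
      simp only at hik
      rw [hik] at h1
      exact h1.symm.trans h2
  have hbV : ∀ i, ∀ x ∈ (P i).V, ∀ p ∈ below x, p ∈ (P i).V := by
    intro i x hx p hp
    rw [hbelow i x hx] at hp
    exact (P i).below_subset_V x hx hp
  refine ⟨⟨V, z, par, height, s, below, weight, ?_, ?_, ?_, ?_, ?_, ?_, ?_, ?_, ?_, ?_, ?_, ?_⟩,
    fun x hx => (hV x).1 hx, ?_⟩
  · exact (hV z).2 (Or.inl rfl)
  · intro x hx hxz
    obtain ⟨i, hi⟩ := hVz x hx hxz
    by_cases hxr : x = (P i).root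
    · rw [hxr, hpar_root]; exact (hV z).2 (Or.inl rfl)
    · rw [hpar i x hi hxr]; exact hVi i _ ((P i).par_mem x hi hxr)
  · intro x hx hxz
    obtain ⟨i, hi⟩ := hVz x hx hxz
    by_cases hxr : x = (P i).root
    · rw [hheight i x hi, hxr, hpar_root, hheightz]; omega
    · rw [hpar i x hi hxr, hheight i x hi, hheight i _ ((P i).par_mem x hi hxr)]
      exact Nat.succ_lt_succ ((P i).height_lt x hi hxr)
  · intro x hx
    by_cases hxz : x = z
    · subst hxz; rw [hbelowz]; exact hx
    · obtain ⟨i, hi⟩ := hVz x hx hxz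
      rw [hbelow i x hi]; exact (P i).self_mem x hi
  · intro x hx hxz
    obtain ⟨i, hi⟩ := hVz x hx hxz
    by_cases hxr : x = (P i).root
    · have h : par x = z := by rw [hxr, hpar_root]
      rw [h, hbelowz]
      exact fun p hp => hVi i p (hbV i x hi p hp)
    · rw [hpar i x hi hxr, hbelow i x hi, hbelow i _ ((P i).par_mem x hi hxr)]
      exact (P i).below_subset x hi hxr
  · intro x hx
    by_cases hxz : x = z
    · rw [hxz, hbelowz]
    · obtain ⟨i, hi⟩ := hVz x hx hxz
      exact fun p hp => hVi i p (hbV i x hi p hp)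
  · intro x hx hxz
    obtain ⟨i, hi⟩ := hVz x hx hxz
    by_cases hxr : x = (P i).root
    · rw [hs i x hi, hxr, hpar_root, hsz]; exact hlabel i
    · rw [hpar i x hi hxr, hs i x hi, hs i _ ((P i).par_mem x hi hxr)]
      exact (P i).label_le x hi hxr
  · intro x hx hxz p hp
    obtain ⟨i, hi⟩ := hVz x hx hxz
    by_cases hxr : x = (P i).root
    · have h : par x = z := by rw [hxr, hpar_root]
      rw [h, hsz]; exact hz i p (hbV i x hi p hp)
    · rw [hpar i x hi hxr, hs i _ ((P i).par_mem x hi hxr)]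
      rw [hbelow i x hi] at hp
      exact (P i).le_dist_self x hi hxr p hp
  · intro x hx y hy hxz hyz hxy hpxy p hp q hq
    obtain ⟨i, hi⟩ := hVz x hx hxz
    obtain ⟨k, hk⟩ := hVz y hy hyz
    by_cases hxr : x = (P i).root
    · have h : par x = z := by rw [hxr, hpar_root]
      have hyr : y = (P k).root := by
        by_contra hyr
        rw [h, hpar k y hk hyr] at hpxy
        exact hne k _ ((P k).par_mem y hk hyr) hpxy.symm
      have hik : i ≠ k := by
        rintro rfl
        exact hxy (hxr.trans hyr.symm)
      rw [h, hsz]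
      exact hsep i k hik p (hbV i x hi p hp) q (hbV k y hk q hq)
    · have hxp := (P i).par_mem x hi hxr
      have hpx := hpar i x hi hxr
      have hyr : y ≠ (P k).root := by
        rintro rfl
        rw [hpar_root, hpx] at hpxy
        exact hne i _ hxp hpxy
      have hpy := hpar k y hk hyr
      have hik : i = k := by
        rw [← hc i _ hxp, ← hc k _ ((P k).par_mem y hk hyr), ← hpx, ← hpy, hpxy]
      subst hik
      rw [hpx, hs i _ hxp]
      rw [hbelow i x hi] at hp
      rw [hbelow i y hk] at hq
      exact (P i).le_dist x hi y hk hxr hyr hxy (hpx ▸ hpy ▸ hpxy) p hp q hq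
  · intro x hx p hp q hq
    by_cases hxz : x = z
    · rw [hxz, hbelowz] at hp hq
      rw [hxz, hsz]
      rcases (hV p).1 hp with rfl | ⟨i, hi⟩ <;> rcases (hV q).1 hq with rfl | ⟨k, hk⟩
      · rw [dist_self]; positivity
      · exact hzdiam k q hk
      · rw [dist_comm]; exact hzdiam i p hi
      · exact hdiam i k p hi q hk
    · obtain ⟨i, hi⟩ := hVz x hx hxz
      rw [hbelow i x hi] at hp hq
      rw [hs i x hi]
      exact (P i).diam_le x hi p hp q hq
  · rw [hweightz, hsz]
    exact mul_le_mul_of_nonneg_left (sqrt_log_succ_mono hchildrenz) (zpow_nonneg hr.le _)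
  · intro x hx hxz
    obtain ⟨i, hi⟩ := hVz x hx hxz
    have hmono := mul_le_mul_of_nonneg_left
      (sqrt_log_succ_mono (Finset.card_le_card (hchildren i x))) (zpow_nonneg hr.le ((P i).s x))
    rw [hweight i x hi, hs i x hi]
    by_cases hxr : x = (P i).root
    · have h : par x = z := by rw [hxr, hpar_root]
      rw [h, hweightz]
      subst hxr
      have := (P i).weight_root
      linarith
    · rw [hpar i x hi hxr, hweight i _ ((P i).par_mem x hi hxr)]
      have := (P i).weight_le x hi hxr
      linarith
  · intro x hx hleaf
    by_cases hxz : x = z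
    · subst hxz
      have : 0 < Fintype.card ι := Fintype.card_pos
      simp only at hleaf
      rw [hleaf, Finset.card_empty] at hchildrenz
      omega
    · obtain ⟨i, hi⟩ := hVz x hx hxz
      simp only at hleaf
      change g + w ≤ weight x
      rw [hweight i x hi]
      have := hw i x hi (Finset.subset_empty.1 (hleaf ▸ hchildren i x))
      linarith

/-- A tree in a small ball may be assumed to have a small root label. -/
theorem exists_label_root_le (hr : 4 < r) (P : ParentTree X r) {t : X} {j : ℤ} {w : ℝ}
    (hP : (P.V : Set X) ⊆ Metric.closedBall t (r ^ (j - 3))) (hw : P.ValueGE w) :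
    ∃ Q : ParentTree X r, Q.V ⊆ P.V ∧ Q.ValueGE w ∧ Q.s Q.root ≤ j - 2 := by
  classical
  have hr0 : 0 < r := by linarith
  by_cases hroot : parentChildren P.V P.root P.par P.root = ∅
  · refine ⟨singleton hr0 P.root (j - 2), by simpa [singleton] using P.root_mem, ?_, le_rfl⟩
    intro x _ _
    have h1 := hw P.root P.root_mem hroot
    have h2 := P.weight_root
    rw [hroot] at h2
    simp at h2
    exact h1.trans h2
  · obtain ⟨y, hy⟩ := Finset.nonempty_iff_ne_empty.2 hroot
    rw [mem_parentChildren] at hy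
    refine ⟨P, subset_rfl, hw, ?_⟩
    have h1 := P.le_dist_self y hy.1 hy.2.1 y (P.self_mem y hy.1)
    rw [hy.2.2] at h1
    have h2 := dist_triangle_right P.root y t
    have h3 : dist P.root t ≤ r ^ (j - 3) := hP P.root_mem
    have h4 : dist y t ≤ r ^ (j - 3) := hP hy.1
    -- A child of the root lies within `2 * r ^ (j - 3)` of it, so separation gives `r ^ (s - 1) ≤ 4
    -- * r ^ (j - 3)` for the root label `s`; this is where `4 < r` enters.
    have h5 : r ^ (P.s P.root - 1) < r ^ (j - 2) := by
      have : r ^ (j - 2) = r ^ (j - 3) * r := by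
        rw [← zpow_add_one₀ hr0.ne']; congr 1; ring
      rw [this]
      have : 0 < r ^ (j - 3) := by positivity
      nlinarith
    have := (zpow_lt_zpow_iff_right₀ (by linarith : 1 < r)).1 h5
    omega

end ParentTree

/-! ### The tree functional and its growth condition -/

/-- The supremum of the values of the separated trees in `A`. -/
def treeSup {X : Type*} [MetricSpace X] (r : ℝ) (A : Set X) : ℝ≥0∞ :=
  ⨆ (w : ℝ) (_ : ∃ P : ParentTree X r, (P.V : Set X) ⊆ A ∧ P.ValueGE w), ENNReal.ofReal w

section treeSup

variable {X : Type*} [MetricSpace X] {r : ℝ}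

theorem treeSup_mono {A B : Set X} (h : A ⊆ B) : treeSup r A ≤ treeSup r B :=
  iSup₂_le fun w hw => le_iSup₂_of_le w
    (hw.imp fun _ hP => ⟨hP.1.trans h, hP.2⟩) le_rfl

theorem treeSup_le_supVal (hr : 0 < r) (A : Set X) : treeSup r A ≤ supVal X r :=
  iSup₂_le fun _ ⟨P, hP⟩ => P.ofReal_le_supVal hr hP.2

theorem exists_of_lt_treeSup {A : Set X} {a : ℝ≥0} (h : (a : ℝ≥0∞) < treeSup r A) :
    ∃ P : ParentTree X r, (P.V : Set X) ⊆ A ∧ P.ValueGE a := by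
  obtain ⟨w, hw⟩ := lt_iSup_iff.1 h
  obtain ⟨⟨P, hP⟩, hlt⟩ := lt_iSup_iff.1 hw
  refine ⟨P, hP.1, fun x hx hl => le_trans ?_ (hP.2 x hx hl)⟩
  rw [← ENNReal.ofReal_coe_nnreal, ENNReal.ofReal_lt_ofReal_iff'] at hlt
  exact hlt.1.le

/-- The growth condition. -/
theorem add_le_treeSup (hr : 16 ≤ r) {ι : Type*} [Fintype ι] [Nonempty ι] {A : Set X} (j : ℤ)
    {t₀ z : X} (t : ι → X) (hA : A ⊆ Metric.closedBall t₀ (r ^ j)) (hz : z ∈ A)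
    (htA : ∀ i, t i ∈ A) (hsep : ∀ i k, i ≠ k → r ^ (j - 1) ≤ dist (t i) (t k))
    (hzsep : ∀ i, r ^ (j - 1) ≤ dist z (t i)) {G : ℝ≥0∞}
    (hG : ∀ i, G ≤ treeSup r (A ∩ Metric.closedBall (t i) (r ^ (j - 3)))) :
    ENNReal.ofReal (r ^ j * √(Real.log ((Fintype.card ι + 1 : ℕ) : ℝ))) + G ≤ treeSup r A := by
  classical
  have hr0 : 0 < r := by linarith
  have hρ : 0 < r ^ (j - 3) := by positivity
  -- Replacing two centres by points of their small balls therefore costs at most half of the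
  -- separation `r ^ (j - 1)`.
  have hρ1 : 4 * r ^ (j - 3) ≤ r ^ (j - 1) := by
    have h1 : r ^ (j - 1) = r ^ (j - 3) * r ^ 2 := by
      rw [← zpow_natCast, ← zpow_add₀ hr0.ne']; congr 1; push_cast; ring
    have h2 : 4 ≤ r ^ 2 := by nlinarith
    rw [h1]
    nlinarith
  have key : ∀ a : ℝ≥0, (∀ i, ∃ P : ParentTree X r,
      (P.V : Set X) ⊆ A ∩ Metric.closedBall (t i) (r ^ (j - 3)) ∧ P.ValueGE a) →
      ENNReal.ofReal (r ^ j * √(Real.log ((Fintype.card ι + 1 : ℕ) : ℝ))) + a ≤ treeSup r A := by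
    intro a ha
    have ha' : ∀ i, ∃ P : ParentTree X r,
        (P.V : Set X) ⊆ A ∩ Metric.closedBall (t i) (r ^ (j - 3)) ∧ P.ValueGE a ∧
        P.s P.root ≤ j - 2 := by
      intro i
      obtain ⟨P, hP, hPa⟩ := ha i
      obtain ⟨Q, hQ, hQa⟩ := P.exists_label_root_le (by linarith)
        (hP.trans Set.inter_subset_right) hPa
      exact ⟨Q, (Finset.coe_subset.2 hQ).trans hP, hQa⟩
    choose P hP hPa hPs using ha'
    have hmem : ∀ i, ∀ p ∈ (P i).V, p ∈ A ∧ dist p (t i) ≤ r ^ (j - 3) := fun i p hp => hP i hp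
    have hdiam : ∀ p ∈ A, ∀ q ∈ A, dist p q ≤ 4 * r ^ j := by
      intro p hp q hq
      have h1 : dist p t₀ ≤ r ^ j := hA hp
      have h2 : dist q t₀ ≤ r ^ j := hA hq
      have := dist_triangle_right p q t₀
      have : 0 < r ^ j := by positivity
      linarith
    obtain ⟨Q, hQ, hQw⟩ := ParentTree.exists_glue hr0 P z j (w := a)
      (by
        intro i k hik p hp q hq
        have h1 := (hmem i p hp).2
        have h2 := (hmem k q hq).2
        have h3 := hsep i k hik
        have h4 := dist_triangle4 (t i) p q (t k)
        rw [dist_comm (t i) p] at h4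
        linarith)
      (by
        intro i p hp
        have h1 := (hmem i p hp).2
        have h3 := hzsep i
        have h4 := dist_triangle z p (t i)
        linarith)
      hPs (fun i k p hp q hq => hdiam p (hmem i p hp).1 q (hmem k q hq).1)
      (fun i p hp => hdiam z hz p (hmem i p hp).1) hPa
    have hQA : (Q.V : Set X) ⊆ A := by
      intro x hx
      rcases hQ x hx with rfl | ⟨i, hi⟩
      · exact hz
      · exact (hmem i x hi).1
    refine le_trans ?_ (le_iSup₂_of_le _ ⟨Q, hQA, hQw⟩ le_rfl)
    rw [ENNReal.ofReal_add (by positivity) (NNReal.coe_nonneg a), ENNReal.ofReal_coe_nnreal]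
  -- The case of value `0` makes the truncated subtraction below legitimate; `G` is then approached
  -- by finite `a < G`.
  have h0 := key 0 fun i => ⟨ParentTree.singleton hr0 (t i) 0,
    by simp [ParentTree.singleton, htA i, hρ.le], fun x _ _ => le_rfl⟩
  rw [ENNReal.coe_zero, add_zero] at h0
  refine add_le_of_le_tsub_left_of_le h0 (ENNReal.le_of_forall_nnreal_lt fun a ha => ?_)
  exact ENNReal.le_sub_of_add_le_left ENNReal.ofReal_ne_top
    (key a fun i => exists_of_lt_treeSup (ha.trans_le (hG i)))

end treeSup

/-! ### Greedy splitting of a piece -/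

theorem exists_forall_le_add {X : Type*} {D : Set X} (hD : D.Nonempty) {g : X → ℝ≥0∞}
    {S ε : ℝ≥0∞} (hS : S ≠ ∞) (hg : ∀ x ∈ D, g x ≤ S) (hε : ε ≠ 0) :
    ∃ t ∈ D, ∀ x ∈ D, g x ≤ g t + ε := by
  set G := ⨆ x ∈ D, g x
  have hGS : G ≤ S := iSup₂_le hg
  have hle : ∀ x ∈ D, g x ≤ G := fun x hx => le_iSup₂ (f := fun x (_ : x ∈ D) => g x) x hx
  by_cases hG : G = 0
  · obtain ⟨t, ht⟩ := hD
    exact ⟨t, ht, fun x hx => by have := hle x hx; rw [hG] at this; exact this.trans (zero_le)⟩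
  · have hlt : G - ε < G := ENNReal.sub_lt_self (ne_top_of_le_ne_top hS hGS) hG hε
    obtain ⟨t, ht, h⟩ := lt_biSup_iff.1 hlt
    exact ⟨t, ht, fun x hx => (hle x hx).trans (tsub_le_iff_right.1 h.le)⟩

/-- Greedy removal of `m` balls of radius `a` from `C`: the points with index `m` remain. -/
theorem exists_greedy {X : Type*} [MetricSpace X] [Nonempty X] {F : Set X → ℝ≥0∞}
    (hF : Monotone F) (hS : F Set.univ ≠ ∞) (C : Set X) (a ρ : ℝ) {ε : ℝ≥0∞} (hε : ε ≠ 0)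
    (m : ℕ) :
    ∃ (idx : X → ℕ) (t : ℕ → X), (∀ x, idx x ≤ m) ∧
      (∀ x ∈ C, idx x < m → dist x (t (idx x)) ≤ a) ∧
      ∀ x ∈ C, idx x = m → (∀ i < m, t i ∈ C ∧ a ≤ dist x (t i) ∧
        F ({y ∈ C | idx y = m} ∩ Metric.closedBall x ρ) ≤
          F (C ∩ Metric.closedBall (t i) ρ) + ε) ∧
        ∀ i < m, ∀ k < m, i ≠ k → a ≤ dist (t i) (t k) := by
  classical
  induction m with
  | zero => exact ⟨fun _ => 0, fun _ => Classical.arbitrary X, by simp, by simp, by simp⟩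
  | succ m ih =>
    obtain ⟨idx, t, h1, h2, h3⟩ := ih
    set D := {y ∈ C | idx y = m} with hDdef
    rcases D.eq_empty_or_nonempty with hD | hD
    -- Nothing is left to remove, and no point gets the index `m + 1`.
    · refine ⟨idx, t, fun x => (h1 x).trans (Nat.le_succ m), fun x hx _ => h2 x hx ?_, ?_⟩
      · refine lt_of_le_of_ne (h1 x) fun h => ?_
        have : x ∈ D := ⟨hx, h⟩
        simp [hD] at this
      · intro x _ h
        have := h1 x
        omega
    · obtain ⟨c, hc, hmax⟩ := exists_forall_le_add hD (g := fun x => F (D ∩ Metric.closedBall x ρ))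
        hS (fun x _ => hF (Set.subset_univ _)) hε
      have hc3 := h3 c hc.1 hc.2
      let idx' : X → ℕ := fun x => if idx x = m ∧ a ≤ dist x c then m + 1 else idx x
      have hidx : ∀ x, idx' x = m + 1 ↔ idx x = m ∧ a ≤ dist x c := by
        intro x
        simp only [idx']
        split_ifs with h
        · simpa using h
        · have := h1 x
          exact ⟨fun h' => by omega, fun h' => absurd h' h⟩
      have hsub : {y ∈ C | idx' y = m + 1} ⊆ D := fun y hy => ⟨hy.1, ((hidx y).1 hy.2).1⟩
      refine ⟨idx', Function.update t m c, ?_, ?_, ?_⟩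
      · intro x
        have := h1 x
        simp only [idx']
        split_ifs <;> omega
      · intro x hx hlt
        have hne : ¬ (idx x = m ∧ a ≤ dist x c) := fun h => by
          have := (hidx x).2 h
          omega
        have heq : idx' x = idx x := if_neg hne
        rw [heq]
        by_cases hxm : idx x = m
        · rw [hxm, Function.update_self]
          exact (not_le.1 fun h => hne ⟨hxm, h⟩).le
        · rw [Function.update_of_ne hxm]
          exact h2 x hx (lt_of_le_of_ne (h1 x) hxm)
      · intro x hx hxm
        have hx' := (hidx x).1 hxm
        have hx3 := h3 x hx hx'.1
        have hmono : F ({y ∈ C | idx' y = m + 1} ∩ Metric.closedBall x ρ) ≤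
            F (D ∩ Metric.closedBall x ρ) := hF (Set.inter_subset_inter_left _ hsub)
        refine ⟨?_, ?_⟩
        · intro i hi
          by_cases him : i = m
          · subst him
            rw [Function.update_self]
            refine ⟨hc.1, hx'.2, hmono.trans ((hmax x ⟨hx, hx'.1⟩).trans ?_)⟩
            exact add_le_add_left (hF (Set.inter_subset_inter_left _ fun y hy => hy.1)) _
          · rw [Function.update_of_ne him]
            have := hx3.1 i (by omega)
            exact ⟨this.1, this.2.1, hmono.trans this.2.2⟩
        · intro i hi k hk hik
          by_cases him : i = m
          · subst him
            rw [Function.update_self, Function.update_of_ne hik.symm]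
            exact (hc3.1 k (by omega)).2.1
          · by_cases hkm : k = m
            · subst hkm
              rw [Function.update_self, Function.update_of_ne hik, dist_comm]
              exact (hc3.1 i (by omega)).2.1
            · rw [Function.update_of_ne him, Function.update_of_ne hkm]
              exact hc3.2 i (by omega) k (by omega) hik

theorem half_mul_le_sqrt_log (n : ℕ) :
    1 / 2 * (2 : ℝ) ^ ((n : ℝ) / 2) ≤ √(Real.log ((2 ^ 2 ^ n : ℕ) : ℝ)) := by
  apply Real.le_sqrt_of_sq_le
  have h1 : ((2 : ℝ) ^ ((n : ℝ) / 2)) ^ 2 = 2 ^ n := by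
    rw [← Real.rpow_natCast, ← Real.rpow_mul (by norm_num), ← Real.rpow_natCast]
    congr 1
    push_cast
    ring
  push_cast
  rw [mul_pow, h1, Real.log_pow]
  have := Real.log_two_gt_d9
  have h2 : (0 : ℝ) < 2 ^ n := by positivity
  push_cast
  nlinarith

/-- One step of the partitioning scheme. The points of index `2 ^ 2 ^ n - 1` form the piece that is
not contained in a smaller ball. -/
theorem exists_split {X : Type*} [MetricSpace X] [Nonempty X] {r : ℝ} (hr : 16 ≤ r)
    (hS : treeSup r (Set.univ : Set X) ≠ ∞) (n : ℕ) (j : ℤ) (C : Set X) :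
    ∃ idx : X → ℕ, (∀ x, idx x < 2 ^ 2 ^ n) ∧
      (∀ x ∈ C, idx x + 1 ≠ 2 ^ 2 ^ n →
        ∃ t, {y ∈ C | idx y = idx x} ⊆ Metric.closedBall t (r ^ (j - 1))) ∧
      ((∃ t, C ⊆ Metric.closedBall t (r ^ j)) → ∀ x ∈ C, idx x + 1 = 2 ^ 2 ^ n →
        treeSup r ({y ∈ C | idx y = idx x} ∩ Metric.closedBall x (r ^ (j - 3))) +
          ENNReal.ofReal (1 / 4 * (2 ^ ((n : ℝ) / 2) * r ^ j)) ≤ treeSup r C) := by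
  have hr0 : 0 < r := by linarith
  set ε := ENNReal.ofReal (1 / 4 * (2 ^ ((n : ℝ) / 2) * r ^ j)) with hεdef
  have hε : ε ≠ 0 := by
    rw [hεdef, Ne, ENNReal.ofReal_eq_zero, not_le]
    positivity
  have htwo : 2 ≤ 2 ^ 2 ^ n := by
    calc 2 = 2 ^ 1 := rfl
      _ ≤ 2 ^ 2 ^ n := Nat.pow_le_pow_right (by norm_num) Nat.one_le_two_pow
  obtain ⟨m, hm⟩ : ∃ m, 2 ^ 2 ^ n = m + 1 := ⟨2 ^ 2 ^ n - 1, by omega⟩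
  obtain ⟨idx, t, h1, h2, h3⟩ := exists_greedy (F := treeSup r)
    (fun A B h => treeSup_mono h) hS C (r ^ (j - 1)) (r ^ (j - 3)) hε m
  refine ⟨idx, fun x => by have := h1 x; omega, ?_, ?_⟩
  · intro x hx hxm
    refine ⟨t (idx x), fun y hy => ?_⟩
    have hlt : idx y < m := by
      have := h1 y
      have := hy.2
      omega
    have := h2 y hy.1 hlt
    rwa [hy.2] at this
  · rintro ⟨t₀, ht₀⟩ x hx hxm
    have hxm' : idx x = m := by omega
    obtain ⟨h4, h5⟩ := h3 x hx hxm'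
    rw [hxm']
    have : NeZero m := ⟨by omega⟩
    set W := treeSup r ({y ∈ C | idx y = m} ∩ Metric.closedBall x (r ^ (j - 3)))
    -- The surviving point `x` is the new root. With the `m = 2 ^ 2 ^ n - 1` centres as children,
    -- `Δ` is exactly `2 ^ 2 ^ n`.
    have hgrow := add_le_treeSup hr j (z := x) (ι := Fin m) (fun i => t i) ht₀ hx
      (fun i => (h4 i i.2).1)
      (fun i k hik => h5 i i.2 k k.2 fun h => hik (Fin.ext h)) (fun i => (h4 i i.2).2.1)
      (G := W - ε) (fun i => tsub_le_iff_right.2 (h4 i i.2).2.2)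
    rw [Fintype.card_fin, ← hm] at hgrow
    refine le_trans ?_ hgrow
    -- One `ε` pays for the near-maximality of the centres, the other is the net gain.
    have hgain : ε + ε ≤ ENNReal.ofReal (r ^ j * √(Real.log ((2 ^ 2 ^ n : ℕ) : ℝ))) := by
      rw [hεdef, ← ENNReal.ofReal_add (by positivity) (by positivity)]
      apply ENNReal.ofReal_le_ofReal
      have := mul_le_mul_of_nonneg_left (half_mul_le_sqrt_log n) (zpow_nonneg hr0.le j)
      linarith
    calc W + ε ≤ (W - ε + ε) + ε := by gcongr; exact le_tsub_add
      _ = (ε + ε) + (W - ε) := by ring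
      _ ≤ _ := by gcongr

/-! ### Summation along the pieces of one point -/

theorem sum_le_of_forall_lt (s : Finset ℕ) (j : ℕ → ℤ) (b f : ℕ → ℝ) (S : ℝ) (hS : 0 ≤ S)
    (hf : ∀ k, f k ≤ S)
    (hs : ∀ m ∈ s, ∀ n ∈ s, m < n → j n ≤ j m - 4)
    (hb : ∀ n ∈ s, b n ≤ f n) (hbf : ∀ n ∈ s, ∀ k, j k ≤ j n - 4 → b n + f k ≤ f n) :
    ∑ n ∈ s, b n ≤ S := by
  -- Telescoping: the extra `f k` leaves room for the next, larger index.
  have key : (∀ k, (∀ n ∈ s, j k ≤ j n - 4) → ∑ n ∈ s, b n + f k ≤ S) ∧ ∑ n ∈ s, b n ≤ S := by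
    induction s using Finset.induction_on_max with
    | empty => simpa using ⟨hf, hS⟩
    | insert a s hmax ih =>
      have ha : a ∉ s := fun h => lt_irrefl _ (hmax a h)
      obtain ⟨ih, -⟩ := ih (fun m hm n hn => hs m (by simp [hm]) n (by simp [hn]))
        (fun n hn => hb n (by simp [hn])) (fun n hn => hbf n (by simp [hn]))
      have h1 := ih a fun n hn => hs n (by simp [hn]) a (by simp) (hmax n hn)
      rw [Finset.sum_insert ha]
      refine ⟨fun k hk => ?_, ?_⟩
      · have := hbf a (by simp) k (hk a (by simp))
        linarith
      · have := hb a (by simp)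
        linarith
  exact key.2

/-- The summation lemma behind the partitioning scheme. At the steps `n` with `stay n` the label
`j` does not change; the terms of the last such step for each label are controlled by `f`. -/
theorem sum_range_le (stay : ℕ → Prop) (j : ℕ → ℤ) (b f : ℕ → ℝ) (S : ℝ) (hS : 0 ≤ S)
    (hf : ∀ k, f k ≤ S) (hb0 : ∀ n, 0 ≤ b n)
    (hstay : ∀ n, stay n → j (n + 1) = j n ∧ 4 / 3 * b n ≤ b (n + 1) ∧ b (n + 1) ≤ 3 / 2 * b n)
    (hdrop : ∀ n, ¬ stay n → j (n + 1) = j n - 1 ∧ b (n + 1) ≤ 1 / 4 * b n)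
    (hb : ∀ n, stay n → 1 / 4 * b n ≤ f n)
    (hbf : ∀ n, stay n → ∀ k, j k ≤ j n - 4 → 1 / 4 * b n + f k ≤ f n) (N : ℕ) :
    ∑ n ∈ Finset.range N, b n ≤ 8 * b 0 + 146 * S := by
  classical
  set L : ℕ → ℝ := fun N => ∑ n ∈ Finset.range N with stay n ∧ ¬ stay (n + 1), b n with hL
  have hLsucc : ∀ N, L (N + 1) = L N + if stay N ∧ ¬ stay (N + 1) then b N else 0 := by
    intro N
    simp only [hL, Finset.sum_filter, Finset.sum_range_succ]
  -- A run of stays is dominated by its last term, which enters `L` at the first drop after it; a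
  -- run of drops decays geometrically. The terms `3 * b (N + 1)` and `-2 * b (N + 1)` make this an
  -- invariant.
  have hmain : ∀ N, (stay N → ∑ n ∈ Finset.range (N + 1), b n ≤ 8 * (b 0 + L N) + 3 * b (N + 1)) ∧
      (¬ stay N → ∑ n ∈ Finset.range (N + 1), b n ≤ 8 * (b 0 + L N) - 2 * b (N + 1)) := by
    intro N
    induction N with
    | zero =>
      have h0 := hb0 0
      have h1 := hb0 1
      simp only [hL, zero_add, Finset.range_one, Finset.sum_singleton, Finset.range_zero,
        Finset.filter_empty, Finset.sum_empty]
      refine ⟨fun _ => by linarith, fun h => ?_⟩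
      have := (hdrop 0 h).2
      simp only [zero_add] at this
      linarith
    | succ N ih =>
      rw [Finset.sum_range_succ, hLsucc]
      have h0 := hb0 N
      have h1 := hb0 (N + 1)
      have h2 := hb0 (N + 2)
      refine ⟨fun h => ?_, fun h => ?_⟩ <;> by_cases hN : stay N
      · have := ih.1 hN
        have := hstay _ h
        simp only [h, not_true, and_false, if_false]
        linarith
      · have := ih.2 hN
        have := hstay _ h
        simp only [h, not_true, and_false, if_false]
        linarith
      · have := ih.1 hN
        have := hdrop _ h
        have := hstay _ hN
        simp only [h, hN, not_false_eq_true, and_self, if_true]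
        linarith
      · have := ih.2 hN
        have := hdrop _ h
        simp only [hN, false_and, if_false]
        linarith
  have hanti : Antitone j := by
    refine antitone_nat_of_succ_le fun n => ?_
    by_cases h : stay n
    · exact (hstay n h).1.le
    · have := (hdrop n h).1
      omega
  have hLle : ∀ N, L N ≤ 16 * S := by
    intro N
    set s := (Finset.range N).filter fun n => stay n ∧ ¬ stay (n + 1) with hs
    have hsj : ∀ m ∈ s, ∀ n ∈ s, m < n → j n < j m := by
      intro m hm n hn hmn
      have hm' := (Finset.mem_filter.1 hm).2
      have hn' := (Finset.mem_filter.1 hn).2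
      have hne : n ≠ m + 1 := fun h => hm'.2 (h ▸ hn'.1)
      have h1 := hanti (show m + 2 ≤ n by omega)
      have h2 := (hstay m hm'.1).1
      have h3 := (hdrop (m + 1) hm'.2).1
      rw [show m + 1 + 1 = m + 2 from rfl] at h3
      omega
    -- Labels strictly decrease along `s`, hence by at least `4` within a residue class, as the
    -- telescoping requires.
    have hfib : ∀ a : ℤ, ∑ n ∈ s with j n % 4 = a, b n ≤ 4 * S := by
      intro a
      have := sum_le_of_forall_lt (s.filter fun n => j n % 4 = a) j (fun n => 1 / 4 * b n) f S hS
        hf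
        (by
          intro m hm n hn hmn
          rw [Finset.mem_filter] at hm hn
          have := hsj m hm.1 n hn.1 hmn
          omega)
        (fun n hn => hb n (Finset.mem_filter.1 (Finset.mem_filter.1 hn).1).2.1)
        (fun n hn => hbf n (Finset.mem_filter.1 (Finset.mem_filter.1 hn).1).2.1)
      rw [← Finset.mul_sum] at this
      linarith
    have hmaps : ∀ n ∈ s, j n % 4 ∈ Finset.Ico (0 : ℤ) 4 := by
      intro n _
      rw [Finset.mem_Ico]
      omega
    calc L N = ∑ a ∈ Finset.Ico (0 : ℤ) 4, ∑ n ∈ s with j n % 4 = a, b n :=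
          (Finset.sum_fiberwise_of_maps_to hmaps _).symm
      _ ≤ ∑ a ∈ Finset.Ico (0 : ℤ) 4, 4 * S := Finset.sum_le_sum fun a _ => hfib a
      _ = 16 * S := by
        rw [Finset.sum_const, Int.card_Ico, nsmul_eq_mul, show (4 - 0 : ℤ).toNat = 4 from rfl]
        push_cast
        ring
  rcases N with - | N
  · have := hb0 0
    simp only [Finset.range_zero, Finset.sum_empty]
    positivity
  · have h1 := hLle N
    have h2 := hb0 (N + 1)
    by_cases h : stay N
    -- An unfinished run costs `3 * b (N + 1) ≤ 9 / 2 * b N ≤ 18 * S`, which with `8 * 16 * S` gives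
    -- `146 * S`.
    · have h3 := (hmain N).1 h
      have h4 := hb N h
      have h5 := hf N
      have h6 := (hstay N h).2.2
      linarith
    · have h3 := (hmain N).2 h
      linarith

/-! ### The sequence of partitions -/

section partitioning

variable {X : Type*} (idx : ℕ → ℤ → Set X → X → ℕ) (J : ℤ)

/-- The label and the piece of the point `x` after `n` steps of the partitioning scheme given by
the index functions `idx`. -/
def pieceAt : ℕ → X → ℤ × Set X
  | 0, _ => (J, Set.univ)
  | n + 1, x =>
    (if idx n (pieceAt n x).1 (pieceAt n x).2 x + 1 = 2 ^ 2 ^ n then (pieceAt n x).1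
      else (pieceAt n x).1 - 1,
     {y ∈ (pieceAt n x).2 | idx n (pieceAt n x).1 (pieceAt n x).2 y =
        idx n (pieceAt n x).1 (pieceAt n x).2 x})

/-- The index of `x` at the step `n` of the partitioning scheme. -/
def indexAt (n : ℕ) (x : X) : ℕ := idx n (pieceAt idx J n x).1 (pieceAt idx J n x).2 x

/-- The partition after `n` steps. -/
def indexSetoid (n : ℕ) : Setoid X where
  r x y := ∀ i < n, indexAt idx J i x = indexAt idx J i y
  iseqv :=
    { refl := fun _ _ _ => rfl
      symm := fun h i hi => (h i hi).symm
      trans := fun h h' i hi => (h i hi).trans (h' i hi) }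

theorem pieceAt_succ_fst (n : ℕ) (x : X) : (pieceAt idx J (n + 1) x).1 =
    if indexAt idx J n x + 1 = 2 ^ 2 ^ n then (pieceAt idx J n x).1
      else (pieceAt idx J n x).1 - 1 := rfl

theorem pieceAt_succ_snd (n : ℕ) (x : X) : (pieceAt idx J (n + 1) x).2 =
    {y ∈ (pieceAt idx J n x).2 |
      idx n (pieceAt idx J n x).1 (pieceAt idx J n x).2 y = indexAt idx J n x} := rfl

theorem mem_pieceAt (n : ℕ) (x : X) : x ∈ (pieceAt idx J n x).2 := by
  induction n with
  | zero => exact Set.mem_univ x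
  | succ n ih => exact ⟨ih, rfl⟩

theorem pieceAt_antitone (x : X) : Antitone fun n => (pieceAt idx J n x).2 :=
  antitone_nat_of_succ_le fun _ _ hy => hy.1

theorem pieceAt_eq {n : ℕ} {x y : X} (h : indexSetoid idx J n x y) :
    pieceAt idx J n x = pieceAt idx J n y := by
  induction n with
  | zero => rfl
  | succ n ih =>
    have h1 := ih fun i hi => h i (by omega)
    have h2 := h n (by omega)
    apply Prod.ext
    · rw [pieceAt_succ_fst, pieceAt_succ_fst, h1, h2]
    · rw [pieceAt_succ_snd, pieceAt_succ_snd, h1, h2]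

theorem part_indexSetoid_subset (n : ℕ) (x : X) :
    part (indexSetoid idx J n) x ⊆ (pieceAt idx J n x).2 := by
  intro y hy
  rw [← pieceAt_eq idx J (show indexSetoid idx J n y x from hy)]
  exact mem_pieceAt idx J n y

theorem prod_range_two_pow_two_pow (n : ℕ) :
    (∏ i ∈ Finset.range n, 2 ^ 2 ^ i) * 2 = 2 ^ 2 ^ n := by
  induction n with
  | zero => rfl
  | succ n ih =>
    rw [Finset.prod_range_succ, mul_right_comm, ih, ← pow_add, pow_succ]
    congr 1
    ring

/-- A class is determined by its history of indices, and there are `∏_{i<n} 2^(2^i) = 2^(2^n - 1)`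
possible histories. -/
theorem isAdmissible_indexSetoid (hidx : ∀ n j C x, idx n j C x < 2 ^ 2 ^ n) :
    IsAdmissible (indexSetoid idx J) where
  refines n x y h i hi := h i (by omega)
  card_le n := by
    let φ : (∀ i : Fin n, Fin (2 ^ 2 ^ (i : ℕ))) → Set X := fun g =>
      {y | ∀ i : Fin n, indexAt idx J i y = g i}
    have hsub : (indexSetoid idx J n).classes ⊆ φ '' Set.univ := by
      rintro _ ⟨x, rfl⟩
      refine ⟨fun i => ⟨indexAt idx J i x, hidx _ _ _ _⟩, Set.mem_univ _, ?_⟩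
      ext y
      exact ⟨fun h i hi => h ⟨i, hi⟩, fun h i => h i i.2⟩
    refine (Set.encard_le_encard hsub).trans ((Set.encard_image_le _ _).trans ?_)
    rw [Set.encard_univ, ENat.card_eq_coe_fintype_card, Fintype.card_pi]
    simp only [Fintype.card_fin]
    rw [← Finset.prod_range (fun i => 2 ^ 2 ^ i)]
    have := prod_range_two_pow_two_pow n
    norm_cast
    unfold admissibleBound
    split_ifs with h
    · simp [h]
    · omega

end partitioning

/-! ### `γ₂` is bounded by values of separated trees -/

variable {X : Type*} [MetricSpace X] {r : ℝ}

theorem gammaTwo_le_of_dist_le [Nonempty X] (hr : 16 ≤ r)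
    (hS : treeSup r (Set.univ : Set X) ≠ ∞) (J : ℤ) (hJ : ∀ x y : X, dist x y ≤ r ^ J) :
    gammaTwo X ≤ ENNReal.ofReal
      (2 * (8 * r ^ J + 146 * (treeSup r (Set.univ : Set X)).toReal)) := by
  have hr0 : 0 < r := by linarith
  choose idx hidx hball hlast using fun n j C => exists_split (X := X) hr hS n j C
  refine iInf₂_le_of_le (indexSetoid idx J) (isAdmissible_indexSetoid idx J hidx) ?_
  refine iSup_le fun x => ?_
  set j : ℕ → ℤ := fun n => (pieceAt idx J n x).1 with hj
  set C : ℕ → Set X := fun n => (pieceAt idx J n x).2 with hC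
  set b : ℕ → ℝ := fun n => 2 ^ ((n : ℝ) / 2) * r ^ j n with hb
  set stay : ℕ → Prop := fun n => indexAt idx J n x + 1 = 2 ^ 2 ^ n with hstay
  have hmem : ∀ n, x ∈ C n := fun n => mem_pieceAt idx J n x
  have hjstay : ∀ n, stay n → j (n + 1) = j n := fun n h => by
    simp only [hj]
    rw [pieceAt_succ_fst, if_pos h]
  have hjdrop : ∀ n, ¬ stay n → j (n + 1) = j n - 1 := fun n h => by
    simp only [hj]
    rw [pieceAt_succ_fst, if_neg h]
  have hjanti : Antitone j := by
    refine antitone_nat_of_succ_le fun n => ?_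
    by_cases h : stay n
    · exact (hjstay n h).le
    · have := hjdrop n h
      omega
  have hCball : ∀ n, ∃ t, C n ⊆ Metric.closedBall t (r ^ j n) := by
    intro n
    induction n with
    | zero => exact ⟨x, fun y _ => hJ y x⟩
    | succ n ih =>
      by_cases h : stay n
      · obtain ⟨t, ht⟩ := ih
        exact ⟨t, (pieceAt_antitone idx J x (Nat.le_succ n)).trans (by rwa [hjstay n h])⟩
      · rw [hjdrop n h]
        exact hball n _ _ x (hmem n) h
  have hdist : ∀ n, ∀ y ∈ C n, ∀ z ∈ C n, dist y z ≤ 2 * r ^ j n := by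
    intro n y hy z hz
    obtain ⟨t, ht⟩ := hCball n
    have h1 : dist y t ≤ r ^ j n := ht hy
    have h2 : dist z t ≤ r ^ j n := ht hz
    have := dist_triangle_right y z t
    linarith
  have hpart : ∀ n : ℕ, (2 : ℝ≥0∞) ^ ((n : ℝ) / 2) * Metric.ediam (part (indexSetoid idx J n) x) ≤
      ENNReal.ofReal (2 * b n) := by
    intro n
    have h1 : Metric.ediam (part (indexSetoid idx J n) x) ≤ ENNReal.ofReal (2 * r ^ j n) := by
      refine Metric.ediam_le fun y hy z hz => ?_
      rw [edist_dist]
      exact ENNReal.ofReal_le_ofReal (hdist n y (part_indexSetoid_subset idx J n x hy) z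
        (part_indexSetoid_subset idx J n x hz))
    refine (mul_le_mul_right h1 _).trans ?_
    rw [← ofReal_two_rpow, ← ENNReal.ofReal_mul (by positivity)]
    apply ENNReal.ofReal_le_ofReal
    simp only [hb]
    linarith
  set S := (treeSup r (Set.univ : Set X)).toReal
  set f : ℕ → ℝ := fun n => (treeSup r (C n)).toReal with hf
  have hfin : ∀ A : Set X, treeSup r A ≠ ∞ := fun A =>
    ne_top_of_le_ne_top hS (treeSup_mono (Set.subset_univ A))
  have hbpos : ∀ n, 0 ≤ b n := fun n => by positivity
  have hgain : ∀ n, stay n → ∀ A : Set X, A ⊆ C (n + 1) ∩ Metric.closedBall x (r ^ (j n - 3)) →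
      1 / 4 * b n + (treeSup r A).toReal ≤ f n := by
    intro n h A hA
    have h1 := hlast n _ _ (hCball n) x (hmem n) h
    have h2 : treeSup r A + ENNReal.ofReal (1 / 4 * b n) ≤ treeSup r (C n) :=
      (add_le_add_left (treeSup_mono hA) _).trans h1
    have h3 := ENNReal.toReal_mono (hfin _) h2
    rw [ENNReal.toReal_add (hfin _) ENNReal.ofReal_ne_top,
      ENNReal.toReal_ofReal (by have := hbpos n; positivity)] at h3
    linarith
  have hpow : ∀ n : ℕ, (2 : ℝ) ^ (((n + 1 : ℕ) : ℝ) / 2) = √2 * 2 ^ ((n : ℝ) / 2) := by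
    intro n
    rw [Real.sqrt_eq_rpow, ← Real.rpow_add (by norm_num)]
    congr 1
    push_cast
    ring
  have hs1 : 4 / 3 ≤ √(2 : ℝ) := Real.le_sqrt_of_sq_le (by norm_num)
  have hs2 : √(2 : ℝ) ≤ 3 / 2 := Real.sqrt_le_iff.2 ⟨by norm_num, by norm_num⟩
  have hsum := sum_range_le stay j b f S ENNReal.toReal_nonneg
    (fun k => ENNReal.toReal_mono hS (treeSup_mono (Set.subset_univ _))) hbpos
    (fun n h => by
      have h1 : b (n + 1) = √2 * b n := by
        simp only [hb]
        rw [hpow, hjstay n h, mul_assoc]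
      have := hbpos n
      refine ⟨hjstay n h, ?_, ?_⟩ <;> rw [h1] <;> gcongr)
    (fun n h => by
      refine ⟨hjdrop n h, ?_⟩
      have h1 : b (n + 1) * r = √2 * b n := by
        simp only [hb]
        rw [hpow, hjdrop n h, zpow_sub_one₀ hr0.ne']
        field_simp
      have h2 := hbpos n
      have h3 := hbpos (n + 1)
      nlinarith)
    (fun n h => by
      have := hgain n h ∅ (Set.empty_subset _)
      have := ENNReal.toReal_nonneg (a := treeSup r (∅ : Set X))
      linarith)
    -- A label lower by `4` forces `k > n`, and `C k` then has diameter at most `2 * r ^ (j n - 4) ≤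
    -- r ^ (j n - 3)`, so it lies in the small ball around `x`.
    (fun n h k hk => hgain n h (C k) (Set.subset_inter
      (pieceAt_antitone idx J x (by
        by_contra hlt
        have := hjanti (show k ≤ n by omega)
        omega))
      (fun y hy => by
        have h1 := hdist k y hy x (hmem k)
        have h2 : r ^ j k ≤ r ^ (j n - 4) := zpow_le_zpow_right₀ (by linarith) hk
        have h3 : r ^ (j n - 3) = r ^ (j n - 4) * r := by
          rw [← zpow_add_one₀ hr0.ne']; congr 1; ring
        have h4 : 0 < r ^ (j n - 4) := by positivity
        rw [Metric.mem_closedBall, h3]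
        nlinarith)))
  have hb0 : b 0 = r ^ J := by simp [hb, hj, pieceAt]
  rw [hb0] at hsum
  refine ENNReal.tsum_le_of_sum_range_le fun N => ?_
  refine (Finset.sum_le_sum fun n _ => hpart n).trans ?_
  rw [← ENNReal.ofReal_sum_of_nonneg (fun n _ => by have := hbpos n; positivity),
    ← Finset.mul_sum]
  exact ENNReal.ofReal_le_ofReal (by have := hsum N; linarith)

/-- The tree with the single edge from `x` to `y`, its root label the scale just above their
distance, has value at least `dist x y * √(log 2)`, and `√(log 2) ≥ 1 / 2`. -/
theorem dist_le_two_mul_toReal_treeSup (hr : 16 ≤ r)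
    (hS : treeSup r (Set.univ : Set X) ≠ ∞) (x y : X) :
    dist x y ≤ 2 * (treeSup r (Set.univ : Set X)).toReal := by
  rcases eq_or_ne x y with rfl | hxy
  · rw [dist_self]; positivity
  obtain ⟨n, hn1, hn2⟩ := exists_mem_Ioc_zpow (dist_pos.2 hxy) (show 1 < r by linarith)
  have h1 := add_le_treeSup hr (A := {x, y}) (ι := Unit) (n + 1) (t₀ := x) (z := x)
    (fun _ => y) (by
      rintro z (rfl | rfl)
      · simp; positivity
      · rw [Metric.mem_closedBall, dist_comm]; exact hn2)
    (by simp) (by simp) (fun i k h => absurd rfl h)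
    (fun _ => by rw [add_sub_cancel_right]; exact hn1.le) (G := 0) (fun _ => zero_le)
  rw [add_zero] at h1
  have h2 := (ENNReal.ofReal_le_iff_le_toReal hS).1 (h1.trans (treeSup_mono (Set.subset_univ _)))
  have h3 := half_mul_le_sqrt_log 0
  have h4 : (0 : ℝ) ≤ r ^ (n + 1) := by positivity
  norm_num at h2 h3
  nlinarith

theorem gammaTwo_eq_zero [Subsingleton X] : gammaTwo X = 0 := by
  refine le_antisymm ?_ zero_le
  refine iInf₂_le_of_le (fun _ => ⊤) ⟨fun _ => le_rfl, fun k => ?_⟩ ?_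
  · refine le_trans (b := 1) ?_ ?_
    · rw [Set.encard_le_one_iff]
      rintro _ _ ⟨x, rfl⟩ ⟨y, rfl⟩
      rw [Subsingleton.elim x y]
    · unfold admissibleBound
      split_ifs
      · simp
      · exact_mod_cast Nat.one_le_two_pow
  · refine iSup_le fun x => ?_
    simp [Metric.ediam_subsingleton (Set.subsingleton_of_subsingleton (s := part ⊤ x))]

theorem gammaTwo_le_supVal (X : Type*) [MetricSpace X] {r : ℝ} (hr : 16 ≤ r) :
    gammaTwo X ≤ ENNReal.ofReal (32 * r + 292) * supVal X r := by
  have hr0 : 0 < r := by linarith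
  have hC : ENNReal.ofReal (32 * r + 292) ≠ 0 := by
    rw [Ne, ENNReal.ofReal_eq_zero, not_le]; positivity
  refine le_trans ?_ (mul_le_mul_right (treeSup_le_supVal hr0 Set.univ) _)
  by_cases hS : treeSup r (Set.univ : Set X) = ∞
  · rw [hS, ENNReal.mul_top hC]; exact le_top
  rcases subsingleton_or_nontrivial X with hX | hX
  · rw [gammaTwo_eq_zero]; exact zero_le
  set S := (treeSup r (Set.univ : Set X)).toReal with hSdef
  have hdist := dist_le_two_mul_toReal_treeSup (X := X) hr hS
  obtain ⟨x, y, hxy⟩ := exists_pair_ne X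
  have hSpos : 0 < 2 * S := (dist_pos.2 hxy).trans_le (hdist x y)
  -- The starting scale satisfies `r ^ (n + 1) ≤ 2 * r * S`, so the bound becomes `2 * (16 * r +
  -- 146) * S`.
  obtain ⟨n, hn1, hn2⟩ := exists_mem_Ioc_zpow hSpos (show 1 < r by linarith)
  refine (gammaTwo_le_of_dist_le hr hS (n + 1) fun x y => (hdist x y).trans hn2).trans ?_
  rw [← ENNReal.ofReal_toReal hS, ← ENNReal.ofReal_mul (by positivity)]
  apply ENNReal.ofReal_le_ofReal
  rw [ENNReal.toReal_ofReal ENNReal.toReal_nonneg, zpow_add_one₀ hr0.ne', ← hSdef]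
  nlinarith

end MajorizingTrees

end

theorem mainTheorem12 :
    ∃ r₀ : ℝ, 2 ≤ r₀ ∧ ∀ r : ℝ, r₀ ≤ r →
      ∃ C : ℝ≥0, 0 < C ∧ ∀ (X : Type*) [MetricSpace X],
        MajorizingTrees.supVal X r ≤ (C : ℝ≥0∞) * MajorizingTrees.gammaTwo X ∧
        MajorizingTrees.gammaTwo X ≤ (C : ℝ≥0∞) * MajorizingTrees.supVal X r := by
  refine ⟨16, by norm_num, fun r hr => ⟨(32 * r + 292).toNNReal, ?_, fun X _ => ⟨?_, ?_⟩⟩⟩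
  · rw [Real.toNNReal_pos]
    linarith
  · refine (MajorizingTrees.supVal_le_gammaTwo X (by linarith)).trans ?_
    exact mul_le_mul_left (ENNReal.ofReal_le_ofReal (by linarith)) _
  · exact MajorizingTrees.gammaTwo_le_supVal X hr
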